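/- Graphs are finite and may have loops and parallel edges. A graph is \emph{cubic} if every vertex has degree $3$ (loops counting twice), and \emph{$3$-connected} if it has more than three vertices and stays connected after the deletion of any set of at most two vertices. A \emph{signed graph} is a graph $G$ together with a signature $\sigma : E(G) \to \{-1,1\}$; a cycle $C$ of $G$ is \emph{positive} if $\prod_{e \in E(C)} \sigma(e) = 1$. For $S \subseteq E(G)$ and $k \in \mathbb{N}$, the \emph{$k$-closure} $\langle S \rangle_k$ is the smallest set $S'$ with $S \subseteq S' \subseteq E(G)$ such that no positive cycle $C$ of $G$ satisfies $1 \le |E(C) \setminus S'| \le k$. A \emph{$k$-base} of $G$ is a set $B \subseteq E(G)$ with $\langle B \rangle_k = E(G)$. \textbf{Theorem (DeVos).} If $G$ is a $3$-connected cubic signed graph, then there is a partition $E(G) = X_1 \cup X_2$ (with $X_1 \cap X_2 = \emptyset$) such that $X_1$ is the edge set of a spanning tree of $G$ and $X_2$ is a $2$-base of $G$. -/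

import Mathlib

open scoped Graph

namespace Graph

variable {α β : Type*}

/-- A multigraph is connected if it has a vertex and any two vertices are joined by a walk. -/
def IsConnected (G : Graph α β) : Prop :=
  V(G).Nonempty ∧ ∀ x ∈ V(G), ∀ y ∈ V(G), Relation.ReflTransGen G.Adj x y

/-- `k`-connected: more than `k` vertices, and deleting fewer than `k` vertices never
disconnects the graph. Equivalently, every vertex set whose deletion leaves a disconnected graph
or a single vertex has at least `k` elements. -/
def IsVertexConnected (G : Graph α β) (k : ℕ) : Prop :=
  (k : ℕ∞) < V(G).encard ∧
    ∀ S : Set α, S ⊆ V(G) → S.encard < (k : ℕ∞) → (G.deleteVerts S).IsConnected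

/-- The degree of a vertex: the number of incident edges, loops being counted twice. -/
noncomputable def edegree (G : Graph α β) (x : α) : ℕ∞ :=
  (G.incidenceSet x).encard + (G.loopSet x).encard

/-- Every vertex has degree three. -/
def IsCubic (G : Graph α β) : Prop :=
  ∀ x ∈ V(G), G.edegree x = 3

/-- `F` is the edge set of a cycle of `G`: there are distinct vertices `v 0, …, v n` and distinct
edges `e 0, …, e n` with `e i` joining `v i` to `v (i + 1)`, indices being cyclic (addition in
`Fin (n + 1)` is modulo `n + 1`). A loop is a cycle of length one and two parallel edges form a
cycle of length two. -/
def IsCycleEdgeSet (G : Graph α β) (F : Set β) : Prop :=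
  ∃ (n : ℕ) (v : Fin (n + 1) → α) (e : Fin (n + 1) → β),
    Function.Injective v ∧ Function.Injective e ∧
      (∀ i, G.IsLink (e i) (v i) (v (i + 1))) ∧ F = Set.range e

/-- `X` is the edge set of a spanning tree of `G`: the graph with all the vertices of `G`
and edge set `X` is connected and has no cycle. -/
def IsSpanningTree (G : Graph α β) (X : Set β) : Prop :=
  X ⊆ E(G) ∧ (G.restrict X).IsConnected ∧ ∀ F : Set β, ¬ (G.restrict X).IsCycleEdgeSet F

/-- `F` is the edge set of a positive cycle of the signed graph `(G, σ)`: the product of the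
signs of its edges is `1`. -/
def IsPositiveCycle (G : Graph α β) (σ : β → ℤˣ) (F : Set β) : Prop :=
  G.IsCycleEdgeSet F ∧ ∏ᶠ e ∈ F, σ e = 1

/-- No positive cycle `F` of `(G, σ)` satisfies `1 ≤ |F \ S| ≤ k`. -/
def IsKClosed (G : Graph α β) (σ : β → ℤˣ) (k : ℕ) (S : Set β) : Prop :=
  ¬ ∃ F : Set β, G.IsPositiveCycle σ F ∧ 1 ≤ (F \ S).encard ∧ (F \ S).encard ≤ (k : ℕ∞)

/-- The `k`-closure of a set `S` of edges of `(G, σ)`. -/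
def kClosure (G : Graph α β) (σ : β → ℤˣ) (k : ℕ) (S : Set β) : Set β :=
  ⋂₀ {S' : Set β | S' ⊆ E(G) ∧ S ⊆ S' ∧ G.IsKClosed σ k S'}

lemma IsCycleEdgeSet.subset_edgeSet {G : Graph α β} {F : Set β} (h : G.IsCycleEdgeSet F) :
    F ⊆ E(G) := by
  obtain ⟨n, v, e, -, -, hl, rfl⟩ := h
  rintro _ ⟨i, rfl⟩
  exact (hl i).edge_mem

/-- The `k`-closure of `S` is indeed the least set of edges of `G` that contains `S`
and is `k`-closed. -/
theorem isLeast_kClosure (G : Graph α β) (σ : β → ℤˣ) (k : ℕ) {S : Set β} (hS : S ⊆ E(G)) :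
    IsLeast {S' : Set β | S' ⊆ E(G) ∧ S ⊆ S' ∧ G.IsKClosed σ k S'} (G.kClosure σ k S) := by
  refine ⟨⟨?_, ?_, ?_⟩, fun S' hS' ↦ Set.sInter_subset_of_mem hS'⟩
  · refine Set.sInter_subset_of_mem ⟨subset_rfl, hS, ?_⟩
    rintro ⟨F, hF, h1, -⟩
    rw [Set.sdiff_eq_empty.2 hF.1.subset_edgeSet] at h1
    simp at h1
  · exact Set.subset_sInter fun S' hS' ↦ hS'.2.1
  · rintro ⟨F, hF, h1, hk⟩
    obtain ⟨f, hfF, hf⟩ := Set.one_le_encard_iff_nonempty.1 h1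
    simp only [kClosure, Set.mem_sInter, not_forall] at hf
    obtain ⟨S', hS', hfS'⟩ := hf
    refine hS'.2.2 ⟨F, hF, Set.one_le_encard_iff_nonempty.2 ⟨f, hfF, hfS'⟩, ?_⟩
    exact (Set.encard_le_encard
      (Set.sdiff_subset_sdiff_right (Set.sInter_subset_of_mem hS'))).trans hk

/-- A `k`-base of `(G, σ)`: a set of edges whose `k`-closure is the whole edge set. -/
def IsKBase (G : Graph α β) (σ : β → ℤˣ) (k : ℕ) (B : Set β) : Prop :=
  B ⊆ E(G) ∧ G.kClosure σ k B = E(G)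

end Graph

/-! It suffices to find an edge set X such that G − X is connected and every 2-closed set containing
X is all of E(G): the complement of a spanning tree of G − X contains X and is therefore a 2-base. X
is built along a growing vertex set U (`IsStage`). The invariant is that G − X stays connected and
that, in every 2-closed Z ⊇ X, any two distinct vertices of U are joined by paths of both signs that
stay in U and use edges of Z. Once U = V(G), every edge forms a positive cycle with a path of its
own sign, so it lies in Z.

The start is a negative cycle whose edges can be deleted without disconnecting G; the two arcs
between two of its vertices have opposite signs. To enlarge U, take a path P outside U with edges e,
f from its ends to U. Only the edges of P are added to X. A path through U of the right sign turns
e, P, f into a positive cycle whose only edges possibly outside Z are e and f, so 2-closedness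
yields both (`IsLinked.mem_of_ear`), and the new vertices inherit the linkage
(`IsLinked.union_ear`). Cubicity makes the two attachments in U distinct, since each vertex of U
already has two edges inside U.

Connectedness of G − X rests on `exists_nonseparating_isCyc` and `exists_nonseparating_isPath`, two
extremal arguments of the same kind. Make the component M of a fixed vertex z as large as possible
after the deletion. If a component S of the rest exists, the edges leaving S in the ambient subgraph
all lie on the cycle or path; edge connectivity forces several crossings, and rerouting through S
frees an edge between S and M. For paths this takes place in a minimal set B outside U with at most
one edge to the remaining vertices outside U.

If every cycle is positive, signs of paths do not matter; the proposition `bal` switches the sign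
condition off, so that both cases share one proof. -/

namespace Graph

variable {α β : Type*} {G : Graph α β}

/-! ### Walks as lists -/

/-- `G.IsWalk x l y`: the list `l` of pairs (edge, next vertex) describes a walk from `x`
to `y`. -/
def IsWalk (G : Graph α β) : α → List (β × α) → α → Prop
  | x, [], y => x = y
  | x, p :: l, y => G.IsLink p.1 x p.2 ∧ IsWalk G p.2 l y

/-- The edges of a walk, in order. -/
def walkEdges (l : List (β × α)) : List β := l.map Prod.fst

/-- The vertices of a walk starting at `x`, in order. -/
def support (x : α) (l : List (β × α)) : List α := x :: l.map Prod.snd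

/-- The product of the signs of the edges of a walk. -/
def walkSign (σ : β → ℤˣ) (l : List (β × α)) : ℤˣ := (l.map fun p ↦ σ p.1).prod

/-- The reversal of a walk starting at `x`. -/
def walkReverse : α → List (β × α) → List (β × α)
  | _, [] => []
  | x, p :: l => walkReverse p.2 l ++ [(p.1, x)]

@[simp] lemma isWalk_nil {x y : α} : G.IsWalk x [] y ↔ x = y := Iff.rfl

@[simp] lemma isWalk_cons {x y : α} {p : β × α} {l : List (β × α)} :
    G.IsWalk x (p :: l) y ↔ G.IsLink p.1 x p.2 ∧ G.IsWalk p.2 l y := Iff.rfl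

@[simp] lemma walkEdges_nil : walkEdges ([] : List (β × α)) = [] := rfl

@[simp] lemma walkEdges_cons (p : β × α) (l : List (β × α)) :
    walkEdges (p :: l) = p.1 :: walkEdges l := rfl

@[simp] lemma walkEdges_append (l m : List (β × α)) :
    walkEdges (l ++ m) = walkEdges l ++ walkEdges m := List.map_append

@[simp] lemma support_nil (x : α) : support x ([] : List (β × α)) = [x] := rfl

@[simp] lemma support_cons (x : α) (p : β × α) (l : List (β × α)) :
    support x (p :: l) = x :: support p.2 l := rfl

@[simp] lemma support_append (x : α) (l m : List (β × α)) :
    support x (l ++ m) = support x l ++ m.map Prod.snd := by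
  simp [support]

@[simp] lemma walkSign_nil (σ : β → ℤˣ) : walkSign σ ([] : List (β × α)) = 1 := rfl

@[simp] lemma walkSign_cons (σ : β → ℤˣ) (p : β × α) (l : List (β × α)) :
    walkSign σ (p :: l) = σ p.1 * walkSign σ l := by simp [walkSign]

@[simp] lemma walkSign_append (σ : β → ℤˣ) (l m : List (β × α)) :
    walkSign σ (l ++ m) = walkSign σ l * walkSign σ m := by simp [walkSign]

lemma mem_support_self (x : α) (l : List (β × α)) : x ∈ support x l := by simp [support]

lemma isWalk_append {x y : α} {l m : List (β × α)} :
    G.IsWalk x (l ++ m) y ↔ ∃ z, G.IsWalk x l z ∧ G.IsWalk z m y := by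
  induction l generalizing x with
  | nil => simp
  | cons p l ih => simp [ih, and_assoc]

lemma IsWalk.append {x y z : α} {l m : List (β × α)} (hl : G.IsWalk x l y)
    (hm : G.IsWalk y m z) : G.IsWalk x (l ++ m) z := isWalk_append.2 ⟨y, hl, hm⟩

lemma IsWalk.end_mem_support {x y : α} {l : List (β × α)} (h : G.IsWalk x l y) :
    y ∈ support x l := by
  induction l generalizing x with
  | nil => simp_all
  | cons p l ih => simpa using Or.inr (ih h.2)

lemma IsWalk.reverse {x y : α} {l : List (β × α)} (h : G.IsWalk x l y) :
    G.IsWalk y (walkReverse x l) x := by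
  induction l generalizing x with
  | nil => exact Eq.symm h
  | cons p l ih => exact (ih h.2).append ⟨h.1.symm, rfl⟩

@[simp] lemma walkSign_reverse (σ : β → ℤˣ) (x : α) (l : List (β × α)) :
    walkSign σ (walkReverse x l) = walkSign σ l := by
  induction l generalizing x with
  | nil => rfl
  | cons p l ih => simp [walkReverse, ih, mul_comm]

lemma walkEdges_reverse (x : α) (l : List (β × α)) :
    walkEdges (walkReverse x l) = (walkEdges l).reverse := by
  induction l generalizing x with
  | nil => rfl
  | cons p l ih => simp [walkReverse, ih]

lemma IsWalk.support_reverse {x y : α} {l : List (β × α)} (h : G.IsWalk x l y) :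
    support y (walkReverse x l) = (support x l).reverse := by
  induction l generalizing x with
  | nil => simpa [walkReverse] using Eq.symm h
  | cons p l ih => simp [walkReverse, ih h.2]

lemma IsWalk.mem_support_of_inc {x y v : α} {e : β} {l : List (β × α)} (h : G.IsWalk x l y)
    (he : e ∈ walkEdges l) (hv : G.Inc e v) : v ∈ support x l := by
  induction l generalizing x with
  | nil => simp at he
  | cons p l ih =>
    rw [walkEdges_cons, List.mem_cons] at he
    rw [support_cons, List.mem_cons]
    obtain rfl | he := he
    · obtain rfl | rfl := hv.eq_or_eq_of_isLink h.1
      · exact Or.inl rfl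
      · exact Or.inr (mem_support_self _ _)
    · exact Or.inr (ih h.2 he)

lemma IsWalk.exists_link_of_mem {x y : α} {e : β} {l : List (β × α)} (h : G.IsWalk x l y)
    (he : e ∈ walkEdges l) : ∃ a ∈ support x l, ∃ b ∈ support x l, G.IsLink e a b := by
  induction l generalizing x with
  | nil => simp at he
  | cons p l ih =>
    rw [walkEdges_cons, List.mem_cons] at he
    obtain rfl | he := he
    · exact ⟨x, by simp, p.2, by simp [support], h.1⟩
    · obtain ⟨a, ha, b, hb, hab⟩ := ih h.2 he
      exact ⟨a, by simp [ha], b, by simp [hb], hab⟩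

lemma IsWalk.exists_append_of_mem {x y v : α} {l : List (β × α)} (h : G.IsWalk x l y)
    (hv : v ∈ support x l) : ∃ l₁ l₂, l = l₁ ++ l₂ ∧ G.IsWalk x l₁ v ∧ G.IsWalk v l₂ y := by
  induction l generalizing x with
  | nil =>
    obtain rfl : v = x := by simpa using hv
    exact ⟨[], [], rfl, rfl, h⟩
  | cons p l ih =>
    rw [support_cons, List.mem_cons] at hv
    obtain rfl | hv := hv
    · exact ⟨[], p :: l, rfl, rfl, h⟩
    · obtain ⟨l₁, l₂, rfl, h₁, h₂⟩ := ih h.2 hv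
      exact ⟨p :: l₁, l₂, rfl, ⟨h.1, h₁⟩, h₂⟩

lemma IsWalk.nodup_walkEdges {x y : α} {l : List (β × α)} (h : G.IsWalk x l y)
    (hl : (support x l).Nodup) : (walkEdges l).Nodup := by
  induction l generalizing x with
  | nil => simp
  | cons p l ih =>
    rw [support_cons, List.nodup_cons] at hl
    rw [walkEdges_cons, List.nodup_cons]
    exact ⟨fun hp ↦ hl.1 (h.2.mem_support_of_inc hp h.1.inc_left), ih h.2 hl.2⟩

/-! ### Reachability and induced edge sets -/

/-- `y` can be reached from `x` along edges in `F`. -/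
def Reach (G : Graph α β) (F : Set β) : α → α → Prop :=
  Relation.ReflTransGen fun x y ↦ ∃ e ∈ F, G.IsLink e x y

lemma Reach.symm {F : Set β} {x y : α} (h : G.Reach F x y) : G.Reach F y x := by
  induction h with
  | refl => exact Relation.ReflTransGen.refl
  | tail _ hbc ih =>
    obtain ⟨e, he, hbc⟩ := hbc
    exact Relation.ReflTransGen.head ⟨e, he, hbc.symm⟩ ih

lemma Reach.trans {F : Set β} {x y z : α} (h : G.Reach F x y) (h' : G.Reach F y z) :
    G.Reach F x z := Relation.ReflTransGen.trans h h'

lemma Reach.refl {F : Set β} (x : α) : G.Reach F x x := Relation.ReflTransGen.refl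

lemma IsLink.reach {F : Set β} {x y : α} {e : β} (h : G.IsLink e x y) (he : e ∈ F) :
    G.Reach F x y := Relation.ReflTransGen.single ⟨e, he, h⟩

lemma Reach.mono {F F' : Set β} (hF : F ⊆ F') {x y : α} (h : G.Reach F x y) : G.Reach F' x y := by
  induction h with
  | refl => exact Relation.ReflTransGen.refl
  | tail _ hbc ih =>
    obtain ⟨e, he, hbc⟩ := hbc
    exact ih.tail ⟨e, hF he, hbc⟩

lemma Reach.exists_isWalk {F : Set β} {x y : α} (h : G.Reach F x y) :
    ∃ l, G.IsWalk x l y ∧ ∀ e ∈ walkEdges l, e ∈ F := by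
  induction h using Relation.ReflTransGen.head_induction_on with
  | refl => exact ⟨[], rfl, by simp⟩
  | head h _ ih =>
    obtain ⟨e, he, hab⟩ := h
    obtain ⟨l, hl, hlF⟩ := ih
    exact ⟨(e, _) :: l, ⟨hab, hl⟩, by simpa [he] using hlF⟩

lemma IsWalk.reach {F : Set β} {x y : α} {l : List (β × α)} (h : G.IsWalk x l y)
    (hl : ∀ e ∈ walkEdges l, e ∈ F) : G.Reach F x y := by
  induction l generalizing x with
  | nil => exact h ▸ Reach.refl x
  | cons p l ih =>
    rw [walkEdges_cons, List.forall_mem_cons] at hl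
    exact (h.1.reach hl.1).trans (ih h.2 hl.2)

/-- The edges with both ends in `W`. -/
def inside (G : Graph α β) (W : Set α) : Set β := {e | ∃ x ∈ W, ∃ y ∈ W, G.IsLink e x y}

lemma IsLink.mem_inside {W : Set α} {e : β} {x y : α} (h : G.IsLink e x y) (hx : x ∈ W)
    (hy : y ∈ W) : e ∈ G.inside W := ⟨x, hx, y, hy, h⟩

lemma IsLink.mem_of_inside {W : Set α} {e : β} {x y : α} (h : G.IsLink e x y)
    (he : e ∈ G.inside W) : x ∈ W ∧ y ∈ W := by
  obtain ⟨a, ha, b, hb, hab⟩ := he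
  obtain ⟨rfl, rfl⟩ | ⟨rfl, rfl⟩ := h.eq_and_eq_or_eq_and_eq hab
  exacts [⟨ha, hb⟩, ⟨hb, ha⟩]

lemma inside_mono {W W' : Set α} (h : W ⊆ W') : G.inside W ⊆ G.inside W' :=
  fun _ ⟨x, hx, y, hy, hxy⟩ ↦ ⟨x, h hx, y, h hy, hxy⟩

lemma inside_vertexSet : G.inside V(G) = E(G) := by
  ext e
  refine ⟨fun ⟨x, _, y, _, h⟩ ↦ h.edge_mem, fun he ↦ ?_⟩
  obtain ⟨x, y, h⟩ := exists_isLink_of_mem_edgeSet he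
  exact ⟨x, h.left_mem, y, h.right_mem, h⟩

lemma disjoint_inside {W W' : Set α} (h : Disjoint W W') :
    Disjoint (G.inside W) (G.inside W') := by
  rw [Set.disjoint_left]
  rintro e ⟨x, hx, y, hy, hxy⟩ he
  exact Set.disjoint_left.1 h hx (hxy.mem_of_inside he).1

lemma IsWalk.support_subset_of_inside {W : Set α} {x y : α} {l : List (β × α)}
    (h : G.IsWalk x l y) (hx : x ∈ W) (hl : ∀ e ∈ walkEdges l, e ∈ G.inside W) :
    ∀ v ∈ support x l, v ∈ W := by
  induction l generalizing x with
  | nil => simpa using hx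
  | cons p l ih =>
    rw [walkEdges_cons, List.forall_mem_cons] at hl
    rw [support_cons, List.forall_mem_cons]
    exact ⟨hx, ih h.2 (h.1.mem_of_inside hl.1).2 hl.2⟩

/-! ### Extracting signed paths and cycles from walks -/

/-- A closed walk without repeated vertices or edges. -/
def IsCyc (G : Graph α β) (x : α) (l : List (β × α)) : Prop :=
  G.IsWalk x l x ∧ l ≠ [] ∧ (l.map Prod.snd).Nodup ∧ (walkEdges l).Nodup

/-- A walk without repeated vertices. -/
def IsPath (G : Graph α β) (x : α) (l : List (β × α)) (y : α) : Prop :=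
  G.IsWalk x l y ∧ (support x l).Nodup

lemma IsPath.eq_nil {x : α} {l : List (β × α)} (h : G.IsPath x l x) : l = [] := by
  cases l with
  | nil => rfl
  | cons p l => exact absurd h.1.2.end_mem_support (List.nodup_cons.1 h.2).1

lemma IsPath.isCyc_cons {x y : α} {e : β} {l : List (β × α)} (h : G.IsPath y l x)
    (he : G.IsLink e x y) (hel : e ∉ walkEdges l) : G.IsCyc x ((e, y) :: l) :=
  ⟨⟨he, h.1⟩, by simp, h.2, by simpa using ⟨hel, h.1.nodup_walkEdges h.2⟩⟩

/-- In a set of edges without negative cycles, every walk can be replaced by a path of the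
same sign. -/
lemma IsWalk.exists_isPath {σ : β → ℤˣ} {F : Set β}
    (hF : ∀ x l, G.IsCyc x l → (∀ e ∈ walkEdges l, e ∈ F) → walkSign σ l = 1)
    {x y : α} {l : List (β × α)} (h : G.IsWalk x l y) (hl : ∀ e ∈ walkEdges l, e ∈ F) :
    ∃ p, G.IsPath x p y ∧ (∀ e ∈ walkEdges p, e ∈ F) ∧ walkSign σ p = walkSign σ l := by
  induction l generalizing x with
  | nil => exact ⟨[], ⟨h, by simp⟩, by simp, rfl⟩
  | cons q l ih =>
    obtain ⟨e, w⟩ := q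
    rw [walkEdges_cons, List.forall_mem_cons] at hl
    obtain ⟨p, hp, hpF, hps⟩ := ih h.2 hl.2
    have hxw : G.IsLink e x w := h.1
    by_cases hx : x ∈ support w p
    · obtain ⟨p₁, p₂, rfl, h₁, h₂⟩ := hp.1.exists_append_of_mem hx
      have hpn := hp.2
      rw [support_append] at hpn
      have hp₁ : G.IsPath w p₁ x := ⟨h₁, (List.nodup_append.1 hpn).1⟩
      have hp₂ : G.IsPath x p₂ y := by
        refine ⟨h₂, ?_⟩
        rw [List.nodup_append] at hpn
        rw [support, List.nodup_cons]
        exact ⟨fun hx' ↦ hpn.2.2 _ h₁.end_mem_support _ hx' rfl, hpn.2.1⟩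
      simp only [walkEdges_append, List.forall_mem_append] at hpF
      refine ⟨p₂, hp₂, hpF.2, ?_⟩
      -- The discarded part, `e` followed by `p₁`, is closed at `x`. It is a cycle in `F`, hence
      -- positive, unless `p₁` contains `e`; then `p₁` is just `e` traversed back and the sign is a
      -- square.
      have key : σ e * walkSign σ p₁ = 1 := by
        by_cases hep : e ∈ walkEdges p₁
        · cases p₁ with
          | nil => simp at hep
          | cons q p₁ =>
            obtain ⟨e', b⟩ := q
            by_cases hee : e = e'
            · subst hee
              obtain rfl : x = b := hxw.symm.right_unique h₁.1
              obtain rfl : p₁ = [] := IsPath.eq_nil ⟨h₁.2, (List.nodup_cons.1 hp₁.2).2⟩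
              simp
            · simp only [walkEdges_cons, List.mem_cons, hee, false_or] at hep
              exact absurd (IsWalk.mem_support_of_inc h₁.2 hep hxw.inc_right)
                (List.nodup_cons.1 hp₁.2).1
        · simpa using hF x _ (hp₁.isCyc_cons hxw hep) (by simpa [hl.1] using hpF.1)
      rw [walkSign_cons, ← hps, walkSign_append, ← mul_assoc, key, one_mul]
    · exact ⟨(e, w) :: p, ⟨⟨hxw, hp.1⟩, List.nodup_cons.2 ⟨hx, hp.2⟩⟩, by simpa [hl.1] using hpF,
        by simp [hps]⟩

lemma Reach.exists_isPath {F : Set β} {x y : α} (h : G.Reach F x y) :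
    ∃ p, G.IsPath x p y ∧ ∀ e ∈ walkEdges p, e ∈ F := by
  obtain ⟨l, hl, hlF⟩ := h.exists_isWalk
  obtain ⟨p, hp, hpF, -⟩ := hl.exists_isPath (σ := 1) (F := F) (by simp [walkSign]) hlF
  exact ⟨p, hp, hpF⟩

/-- The edge set of a negative closed walk contains a negative cycle. -/
lemma IsWalk.exists_isCyc {σ : β → ℤˣ} {x : α} {l : List (β × α)} (h : G.IsWalk x l x)
    (hs : walkSign σ l = -1) :
    ∃ y c, G.IsCyc y c ∧ (∀ e ∈ walkEdges c, e ∈ walkEdges l) ∧ walkSign σ c = -1 := by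
  by_contra! hcon
  obtain ⟨p, hp, -, hps⟩ := h.exists_isPath (σ := σ) (F := {e | e ∈ walkEdges l})
    (fun y c hc hcl ↦ (Int.units_eq_one_or _).resolve_right (hcon y c hc hcl)) (fun e he ↦ he)
  rw [hp.eq_nil, hs] at hps
  simp at hps

lemma IsCyc.rotate {x v : α} {l : List (β × α)} (h : G.IsCyc x l) (hv : v ∈ support x l) :
    ∃ l', G.IsCyc v l' ∧ l'.Perm l := by
  obtain ⟨l₁, l₂, rfl, h₁, h₂⟩ := h.1.exists_append_of_mem hv
  have hp : (l₂ ++ l₁).Perm (l₁ ++ l₂) := List.perm_append_comm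
  exact ⟨l₂ ++ l₁, ⟨h₂.append h₁, fun h0 ↦ h.2.1 (List.perm_nil.1 (h0 ▸ hp).symm),
    (hp.map _).nodup_iff.2 h.2.2.1, (hp.map _).nodup_iff.2 h.2.2.2⟩, hp⟩

lemma walkSign_perm (σ : β → ℤˣ) {l m : List (β × α)} (h : l.Perm m) :
    walkSign σ l = walkSign σ m := (h.map _).prod_eq

lemma mem_walkEdges_perm {l m : List (β × α)} (h : l.Perm m) {e : β} :
    e ∈ walkEdges l ↔ e ∈ walkEdges m := (h.map _).mem_iff

/-! ### From vertex connectivity to edge connectivity -/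

/-- Every edge cut of `G` contains at least three edges. -/
def IsThreeEdgeConnected (G : Graph α β) : Prop :=
  ∀ S ⊆ V(G), S.Nonempty → (V(G) \ S).Nonempty → ∀ e₁ e₂ : β,
    ∃ e x y, e ≠ e₁ ∧ e ≠ e₂ ∧ x ∈ S ∧ y ∈ V(G) \ S ∧ G.IsLink e x y

lemma Reach.mem_of_closed {F : Set β} {x y : α} (h : G.Reach F x y) {T : Set α} (hx : x ∈ T)
    (hT : ∀ e ∈ F, ∀ a ∈ T, ∀ b, G.IsLink e a b → b ∈ T) : y ∈ T := by
  induction h with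
  | refl => exact hx
  | tail _ hbc ih =>
    obtain ⟨e, he, hbc⟩ := hbc
    exact hT e he _ ih _ hbc

lemma Reach.inside_component {F : Set β} {x y : α} (h : G.Reach F x y) :
    G.Reach (F ∩ G.inside {v | G.Reach F x v}) x y := by
  induction h with
  | refl => exact Reach.refl x
  | tail hab hbc ih =>
    obtain ⟨e, he, hbc⟩ := hbc
    exact ih.trans (hbc.reach ⟨he, hbc.mem_inside hab (Reach.trans hab (hbc.reach he))⟩)

/-- If both sides had a vertex off `D`, a walk between two such vertices in G − D would have to
cross from `S` to its complement, but every crossing edge has an end in `D`. -/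
lemma IsVertexConnected.subset_or_subset (h : G.IsVertexConnected 3) {S D : Set α}
    (hD : D ⊆ V(G)) (hD3 : D.encard < 3)
    (hS : ∀ e, ∀ x ∈ S, ∀ y ∈ V(G) \ S, G.IsLink e x y → x ∈ D ∨ y ∈ D) (hSV : S ⊆ V(G)) :
    S ⊆ D ∨ V(G) \ S ⊆ D := by
  by_contra! hcon
  obtain ⟨⟨s, hs, hsD⟩, ⟨t, ht, htD⟩⟩ := hcon.imp Set.not_subset.1 Set.not_subset.1
  have hst := (h.2 D hD hD3).2 s (by simpa using ⟨hSV hs, hsD⟩) t (by simpa using ⟨ht.1, htD⟩)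
  have : t ∈ S := by
    clear ht htD
    induction hst with
    | refl => exact hs
    | tail _ hbc ih =>
      obtain ⟨e, he⟩ := hbc
      rw [deleteVerts_isLink] at he
      by_contra hc
      have := hS e _ ih _ ⟨he.1.right_mem, hc⟩ he.1
      tauto
  exact ht.2 this

/-- Two edges forming a cut would have ends s₁, s₂ in S and t₁, t₂ outside. Deleting one end of each
edge destroys the cut, so one side lies in the deleted pair. The pairs {s₁, s₂}, {t₁, t₂} and {s₁,
t₂} together leave at most three vertices. -/
lemma IsVertexConnected.isThreeEdgeConnected (h : G.IsVertexConnected 3) :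
    G.IsThreeEdgeConnected := by
  rintro S hS ⟨s₀, hs₀⟩ ⟨t₀, ht₀⟩ e₁ e₂
  by_contra! hcon
  -- An edge that does not cross receives the default ends `s₀`, `t₀`; it imposes no condition.
  have hend : ∀ e, ∃ s ∈ S, ∃ t ∈ V(G) \ S, ∀ x ∈ S, ∀ y ∈ V(G) \ S, G.IsLink e x y →
      x = s ∧ y = t := by
    intro e
    by_cases hc : ∃ x ∈ S, ∃ y ∈ V(G) \ S, G.IsLink e x y
    · obtain ⟨s, hs, t, ht, hst⟩ := hc
      refine ⟨s, hs, t, ht, fun x hx y hy hxy ↦ ?_⟩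
      obtain h | ⟨rfl, rfl⟩ := hxy.eq_and_eq_or_eq_and_eq hst
      · exact h
      · exact absurd hx ht.2
    · push Not at hc
      exact ⟨s₀, hs₀, t₀, ht₀, fun x hx y hy hxy ↦ absurd hxy (hc x hx y hy)⟩
  obtain ⟨s₁, hs₁, t₁, ht₁, h₁⟩ := hend e₁
  obtain ⟨s₂, hs₂, t₂, ht₂, h₂⟩ := hend e₂
  have hpair' : ∀ a b : α, ({a, b} : Set α).encard ≤ 2 := fun a b ↦
    (Set.encard_insert_le _ _).trans (by rw [Set.encard_singleton]; norm_num)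
  have hpair : ∀ a b : α, ({a, b} : Set α).encard < 3 := fun a b ↦
    (hpair' a b).trans_lt (by norm_num)
  have hcross : ∀ e, ∀ x ∈ S, ∀ y ∈ V(G) \ S, G.IsLink e x y →
      (x = s₁ ∧ y = t₁) ∨ (x = s₂ ∧ y = t₂) := by
    intro e x hx y hy hxy
    by_cases he₁ : e = e₁
    · exact Or.inl (h₁ x hx y hy (he₁ ▸ hxy))
    by_cases he₂ : e = e₂
    · exact Or.inr (h₂ x hx y hy (he₂ ▸ hxy))
    exact absurd hxy (hcon e x y he₁ he₂ hx hy)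
  have hSS : S ⊆ {s₁, s₂} := by
    refine (h.subset_or_subset (S := S) (D := {s₁, s₂}) ?_ (hpair _ _) ?_ hS).resolve_right ?_
    · rintro _ (rfl | rfl)
      exacts [hS hs₁, hS hs₂]
    · intro e x hx y hy hxy
      have := hcross e x hx y hy hxy
      simp only [Set.mem_insert_iff, Set.mem_singleton_iff]
      tauto
    · intro hc
      obtain rfl | rfl := hc ht₀
      exacts [ht₀.2 hs₁, ht₀.2 hs₂]
  have hTT : V(G) \ S ⊆ {t₁, t₂} := by
    refine (h.subset_or_subset (S := S) (D := {t₁, t₂}) ?_ (hpair _ _) ?_ hS).resolve_left ?_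
    · rintro _ (rfl | rfl)
      exacts [ht₁.1, ht₂.1]
    · intro e x hx y hy hxy
      have := hcross e x hx y hy hxy
      simp only [Set.mem_insert_iff, Set.mem_singleton_iff]
      tauto
    · intro hc
      obtain rfl | rfl := hc hs₀
      exacts [ht₁.2 hs₀, ht₂.2 hs₀]
  have htriple : ∀ a b c : α, ¬ V(G) ⊆ {a, b, c} := by
    intro a b c hV
    have h1 : V(G).encard ≤ 3 := by
      refine (Set.encard_le_encard hV).trans ((Set.encard_insert_le _ _).trans ?_)
      calc ({b, c} : Set α).encard + 1 ≤ 2 + 1 := by gcongr; exact hpair' b c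
        _ = 3 := by norm_num
    exact absurd h.1 (not_lt.2 h1)
  have hmix := h.subset_or_subset (S := S) (D := {s₁, t₂}) (by
    rintro _ (rfl | rfl)
    exacts [hS hs₁, ht₂.1]) (hpair _ _) (by
    intro e x hx y hy hxy
    have := hcross e x hx y hy hxy
    simp only [Set.mem_insert_iff, Set.mem_singleton_iff]
    tauto) hS
  obtain hc | hc := hmix
  · refine htriple s₁ t₁ t₂ fun v hv ↦ ?_
    by_cases hvS : v ∈ S
    · obtain rfl | rfl := hc hvS
      · simp
      · exact absurd hvS ht₂.2
    · exact Or.inr (hTT ⟨hv, hvS⟩)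
  · refine htriple t₂ s₁ s₂ fun v hv ↦ ?_
    by_cases hvS : v ∈ S
    · exact Or.inr (hSS hvS)
    · obtain rfl | rfl := hc ⟨hv, hvS⟩
      · exact absurd hs₁ hvS
      · simp

lemma IsCubic.not_nodup_four (h : G.IsCubic) {v : α} {a b c d : β} (ha : G.Inc a v)
    (hb : G.Inc b v) (hc : G.Inc c v) (hd : G.Inc d v) : ¬ [a, b, c, d].Nodup := by
  intro hn
  have h3 := h v ha.vertex_mem
  have hle : (G.incidenceSet v).encard ≤ 3 := h3 ▸ le_self_add
  have hsub : ({a, b, c, d} : Set β) ⊆ G.incidenceSet v := by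
    rintro _ (rfl | rfl | rfl | rfl) <;> assumption
  have h4 : ({a, b, c, d} : Set β).encard = 4 := by
    simp only [List.nodup_cons, List.mem_cons, List.not_mem_nil, or_false, not_or] at hn
    rw [Set.encard_insert_of_notMem (by simp; tauto), Set.encard_insert_of_notMem (by simp; tauto),
      Set.encard_pair (by tauto)]
    norm_num
  have := (h4 ▸ Set.encard_le_encard hsub).trans hle
  norm_num at this

/-- A loop at `v` together with three edges of the cut around {v} would be four distinct edges at
`v`. -/
lemma IsThreeEdgeConnected.not_isLink_self (h : G.IsThreeEdgeConnected) (hc : G.IsCubic)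
    (hV : V(G).Nontrivial) (e : β) (v : α) : ¬ G.IsLink e v v := by
  intro he
  obtain ⟨w, hw, hwv⟩ := hV.exists_ne v
  have hcut := h {v} (by simpa using he.left_mem) ⟨v, rfl⟩ ⟨w, hw, by simpa using hwv⟩
  have hne : ∀ g y, y ∈ V(G) \ {v} → G.IsLink g v y → g ≠ e := by
    rintro g y hy hg rfl
    exact hy.2 (hg.right_unique he)
  obtain ⟨a, x, y, -, -, rfl, hy, ha⟩ := hcut e e
  obtain ⟨b, x, y', hba, -, rfl, hy', hb⟩ := hcut a a
  obtain ⟨c, x, y'', hca, hcb, rfl, hy'', hcl⟩ := hcut a b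
  have h1 := hne _ _ hy ha
  have h2 := hne _ _ hy' hb
  have h3 := hne _ _ hy'' hcl
  refine hc.not_nodup_four he.inc_left ha.inc_left hb.inc_left hcl.inc_left ?_
  simp only [List.nodup_cons, List.mem_cons, List.not_mem_nil, or_false, not_or, not_false_eq_true,
    List.nodup_nil, and_true]
  exact ⟨⟨h1.symm, h2.symm, h3.symm⟩, ⟨hba.symm, hca.symm⟩, hcb.symm⟩

/-! ### Crossings of a vertex set by a walk; components of the complement -/

/-- The edge `e` has exactly one end in `S`. -/
def Crosses (G : Graph α β) (S : Set α) (e : β) : Prop := ∃ x ∈ S, ∃ y ∉ S, G.IsLink e x y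

lemma IsLink.crosses_iff {S : Set α} {e : β} {x y : α} (h : G.IsLink e x y) :
    G.Crosses S e ↔ (x ∈ S ∧ y ∉ S) ∨ (x ∉ S ∧ y ∈ S) := by
  refine ⟨fun ⟨a, ha, b, hb, hab⟩ ↦ ?_, ?_⟩
  · obtain ⟨rfl, rfl⟩ | ⟨rfl, rfl⟩ := h.eq_and_eq_or_eq_and_eq hab
    exacts [Or.inl ⟨ha, hb⟩, Or.inr ⟨hb, ha⟩]
  · rintro (⟨hx, hy⟩ | ⟨hx, hy⟩)
    exacts [⟨x, hx, y, hy, h⟩, ⟨y, hy, x, hx, h.symm⟩]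

lemma crosses_compl {S : Set α} {e : β} : G.Crosses Sᶜ e ↔ G.Crosses S e := by
  constructor
  · rintro ⟨x, hx, y, hy, h⟩
    exact ⟨y, by simpa using hy, x, hx, h.symm⟩
  · rintro ⟨x, hx, y, hy, h⟩
    exact ⟨y, hy, x, by simpa using hx, h.symm⟩

lemma IsWalk.not_crosses {S : Set α} {x y : α} {l : List (β × α)} (h : G.IsWalk x l y)
    (hS : ∀ v ∈ support x l, v ∈ S) : ∀ e ∈ walkEdges l, ¬ G.Crosses S e := by
  intro e he
  obtain ⟨a, ha, b, hb, hab⟩ := h.exists_link_of_mem he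
  rw [hab.crosses_iff]
  have := hS a ha
  have := hS b hb
  tauto

lemma IsWalk.exists_exit {S : Set α} {x y : α} {l : List (β × α)} (h : G.IsWalk x l y)
    (hx : x ∈ S) : (∀ v ∈ support x l, v ∈ S) ∨ ∃ l₁ g m l₂ s, l = l₁ ++ (g, m) :: l₂ ∧
      G.IsWalk x l₁ s ∧ (∀ v ∈ support x l₁, v ∈ S) ∧ G.IsLink g s m ∧ m ∉ S ∧
      G.IsWalk m l₂ y := by
  induction l generalizing x with
  | nil => exact Or.inl (by simpa using hx)
  | cons p l ih =>
    by_cases hp : p.2 ∈ S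
    · obtain hl | ⟨l₁, g, m, l₂, s, rfl, h₁, hl₁, hg, hm, h₂⟩ := ih h.2 hp
      · exact Or.inl (by simpa [hx] using hl)
      · exact Or.inr ⟨p :: l₁, g, m, l₂, s, rfl, ⟨h.1, h₁⟩, by simpa [hx] using hl₁, hg, hm, h₂⟩
    · exact Or.inr ⟨[], p.1, p.2, l, x, rfl, rfl, by simpa using hx, h.1, hp, h.2⟩

/-- A walk crosses the boundary of `S` at most once, or leaves `S` and returns to it, or enters
and leaves `S` exactly once. -/
lemma IsWalk.crossing_trichotomy {x y : α} {l : List (β × α)} (h : G.IsWalk x l y) (S : Set α)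
    (e₀ : β) :
    (∃ e₁, ∀ e ∈ walkEdges l, G.Crosses S e → e = e₁) ∨
    (∃ l₁ g m l₂ l₃ s t, l = l₁ ++ (g, m) :: (l₂ ++ l₃) ∧ G.IsWalk x l₁ s ∧ s ∈ S ∧
      G.IsLink g s m ∧ m ∉ S ∧ G.IsWalk m l₂ t ∧ t ∈ S ∧ G.IsWalk t l₃ y) ∨
    (x ∉ S ∧ ∃ l₁ g m l₂ s e₁, l = l₁ ++ (g, m) :: l₂ ∧ G.IsWalk x l₁ s ∧ s ∈ S ∧
      G.IsLink g s m ∧ m ∉ S ∧ ∀ e ∈ walkEdges l, G.Crosses S e → e = e₁ ∨ e = g) := by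
  have hout : ∀ {x y : α} {l : List (β × α)}, G.IsWalk x l y → (∀ v ∈ support x l, v ∈ Sᶜ) →
      ∀ e ∈ walkEdges l, ¬ G.Crosses S e := fun h hl e he ↦
    crosses_compl.not.1 (h.not_crosses hl e he)
  have hin : ∀ {x y : α} {l : List (β × α)}, G.IsWalk x l y → x ∈ S →
      (∀ e ∈ walkEdges l, ¬ G.Crosses S e) ∨
      (∃ l₁ g m l₂ l₃ s t, l = l₁ ++ (g, m) :: (l₂ ++ l₃) ∧ G.IsWalk x l₁ s ∧ s ∈ S ∧
        G.IsLink g s m ∧ m ∉ S ∧ G.IsWalk m l₂ t ∧ t ∈ S ∧ G.IsWalk t l₃ y) ∨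
      (∃ l₁ g m l₂ s, l = l₁ ++ (g, m) :: l₂ ∧ G.IsWalk x l₁ s ∧ s ∈ S ∧
        G.IsLink g s m ∧ m ∉ S ∧ ∀ e ∈ walkEdges l, G.Crosses S e → e = g) := by
    intro x y l h hx
    obtain hl | ⟨l₁, g, m, l₂, s, rfl, h₁, hl₁, hg, hm, h₂⟩ := h.exists_exit hx
    · exact Or.inl (h.not_crosses hl)
    have hs : s ∈ S := hl₁ s h₁.end_mem_support
    by_cases hret : ∀ v ∈ support m l₂, v ∈ Sᶜ
    · refine Or.inr (Or.inr ⟨l₁, g, m, l₂, s, rfl, h₁, hs, hg, hm, fun e he hc ↦ ?_⟩)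
      simp only [walkEdges_append, walkEdges_cons, List.mem_append, List.mem_cons] at he
      obtain he | rfl | he := he
      · exact absurd hc (h₁.not_crosses hl₁ e he)
      · rfl
      · exact absurd hc (hout h₂ hret e he)
    · push Not at hret
      obtain ⟨t, ht, htS⟩ := hret
      obtain ⟨l₃, l₄, rfl, h₃, h₄⟩ := h₂.exists_append_of_mem ht
      exact Or.inr (Or.inl ⟨l₁, g, m, l₃, l₄, s, t, rfl, h₁, hs, hg, hm, h₃, by simpa using htS, h₄⟩)
  by_cases hx : x ∈ S
  · obtain h0 | h0 | ⟨l₁, g, m, l₂, s, rfl, h₁, hs, hg, hm, h₂⟩ := hin h hx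
    · exact Or.inl ⟨e₀, fun e he hc ↦ absurd hc (h0 e he)⟩
    · exact Or.inr (Or.inl h0)
    · exact Or.inl ⟨g, h₂⟩
  obtain hl | ⟨l₁, g, m, l₂, s, rfl, h₁, hl₁, hg, hm, h₂⟩ := h.exists_exit (S := Sᶜ) hx
  · exact Or.inl ⟨e₀, fun e he hc ↦ absurd hc (hout h hl e he)⟩
  have hm' : m ∈ S := by simpa using hm
  obtain h0 | ⟨l₃, g', m', l₄, l₅, s', t, rfl, h₃, hs', hg', hmS', h₄, ht, h₅⟩ |
    ⟨l₃, g', m', l₄, s', rfl, h₃, hs', hg', hmS', h₄⟩ := hin h₂ hm'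
  · refine Or.inl ⟨g, fun e he hc ↦ ?_⟩
    simp only [walkEdges_append, walkEdges_cons, List.mem_append, List.mem_cons] at he
    obtain he | rfl | he := he
    · exact absurd hc (hout h₁ hl₁ e he)
    · rfl
    · exact absurd hc (h0 e he)
  · exact Or.inr (Or.inl ⟨l₁ ++ (g, m) :: l₃, g', m', l₄, l₅, s', t, by simp, h₁.append ⟨hg, h₃⟩,
      hs', hg', hmS', h₄, ht, h₅⟩)
  · refine Or.inr (Or.inr ⟨hx, l₁ ++ (g, m) :: l₃, g', m', l₄, s', g, by simp,
      h₁.append ⟨hg, h₃⟩, hs', hg', hmS', fun e he hc ↦ ?_⟩)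
    rw [walkEdges_append, walkEdges_cons, List.mem_append, List.mem_cons] at he
    obtain he | rfl | he := he
    · exact absurd hc (hout h₁ hl₁ e he)
    · exact Or.inl rfl
    · exact Or.inr (h₄ e he hc)

/-- The vertices of the component containing `z` of the graph induced on `W` with the edges in
`X` deleted. -/
def comp (G : Graph α β) (W : Set α) (X : Set β) (z : α) : Set α :=
  {v | G.Reach (G.inside W \ X) z v}

lemma mem_comp_self (W : Set α) (X : Set β) (z : α) : z ∈ G.comp W X z := Reach.refl z

lemma comp_subset {W : Set α} {X : Set β} {z : α} (hz : z ∈ W) : G.comp W X z ⊆ W :=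
  fun _ hv ↦ Reach.mem_of_closed hv hz fun _ he _ _ _ hab ↦ (hab.mem_of_inside he.1).2

lemma IsLink.mem_comp {W : Set α} {X : Set β} {z a b : α} {e : β} (h : G.IsLink e a b)
    (ha : a ∈ G.comp W X z) (he : e ∈ G.inside W) (heX : e ∉ X) : b ∈ G.comp W X z :=
  Reach.trans ha (h.reach ⟨he, heX⟩)

/-- A component of the graph induced on the complement of `M` in `W`. -/
structure IsSide (G : Graph α β) (W M S : Set α) : Prop where
  nonempty : S.Nonempty
  subset : S ⊆ W
  disjoint : Disjoint M S
  reach : ∀ s ∈ S, ∀ t ∈ S, G.Reach (G.inside S) s t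
  mem_of_isLink : ∀ e, ∀ s ∈ S, ∀ m ∈ W, m ∉ S → G.IsLink e s m → m ∈ M

lemma exists_isSide {W M : Set α} {v : α} (hv : v ∈ W) (hvM : v ∉ M) :
    ∃ S, G.IsSide W M S ∧ v ∈ S := by
  have hsub : ∀ w, G.Reach (G.inside (W \ M)) v w → w ∈ W \ M := fun w hw ↦
    hw.mem_of_closed ⟨hv, hvM⟩ fun _ he _ _ _ hab ↦ (hab.mem_of_inside he).2
  have hS : ∀ w, G.Reach (G.inside (W \ M)) v w →
      G.Reach (G.inside {w | G.Reach (G.inside (W \ M)) v w}) v w :=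
    fun w hw ↦ hw.inside_component.mono Set.inter_subset_right
  refine ⟨{w | G.Reach (G.inside (W \ M)) v w}, ⟨⟨v, Reach.refl v⟩, fun w hw ↦ (hsub w hw).1,
    Set.disjoint_right.2 fun w hw ↦ (hsub w hw).2, fun s hs t ht ↦ (hS s hs).symm.trans (hS t ht),
    fun e s hs m hm hmS he ↦ ?_⟩, Reach.refl v⟩
  by_contra hmM
  exact hmS (Reach.trans hs (he.reach (he.mem_inside (hsub s hs) ⟨hm, hmM⟩)))

/-- Such an edge joins `S` to the component of `z`; if it had survived the deletion of `X`, its end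
in `S` would belong to that component. -/
lemma IsSide.mem_of_crosses {W S : Set α} {X : Set β} {z : α} (h : G.IsSide W (G.comp W X z) S)
    {e : β} (he : e ∈ G.inside W) (hc : G.Crosses S e) : e ∈ X := by
  obtain ⟨a, ha, b, hb, hab⟩ := hc
  by_contra heX
  have hbM := h.mem_of_isLink e a ha b (hab.mem_of_inside he).2 hb hab
  exact Set.disjoint_left.1 h.disjoint (hab.symm.mem_comp hbM he heX) ha

/-- The progress measure of both rerouting arguments. The edges holding the old component together
avoid `X` and have no end in `S`, so they survive the deletion of `X'`, and `g` now attaches the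
vertex `s` as well. -/
lemma IsSide.comp_ssubset {W S : Set α} {X X' : Set β} {z s m : α} {g : β}
    (h : G.IsSide W (G.comp W X z) S) (hX : X' ⊆ X ∪ G.inside S) (hg : G.IsLink g s m)
    (hs : s ∈ S) (hm : m ∉ S) (hgW : g ∈ G.inside W) (hgX : g ∉ X') :
    G.comp W X z ⊂ G.comp W X' z := by
  have hsub : G.comp W X z ⊆ G.comp W X' z := by
    refine fun v hv ↦ Reach.mono ?_ (Reach.inside_component hv)
    rintro e ⟨⟨heW, heX⟩, heM⟩
    refine ⟨heW, fun heX' ↦ ?_⟩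
    obtain heX' | heS := hX heX'
    · exact heX heX'
    · exact Set.disjoint_left.1 (disjoint_inside h.disjoint) heM heS
  refine ⟨hsub, fun hle ↦ ?_⟩
  have hmM := h.mem_of_isLink g s hs m (hg.mem_of_inside hgW).2 hm hg
  exact Set.disjoint_left.1 h.disjoint (hle (hg.symm.mem_comp (hsub hmM) hgW hgX)) hs

/-- Theta-graph parity: a chord of sign `q` splits a negative closed walk into two closed walks
whose signs multiply to −1, so one of them is negative. -/
lemma eq_neg_one_or_of_mul_eq_neg_one :
    ∀ a b c g q : ℤˣ, a * (g * (b * c)) = -1 → a * (q * c) = -1 ∨ g * b * q = -1 := by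
  decide

/-! ### Nonseparating cycles -/

/-- A graph whose edge cuts have at least three edges and that has a negative cycle has a
negative cycle whose edges can be deleted without disconnecting the graph. -/
theorem IsThreeEdgeConnected.exists_nonseparating_isCyc (h3 : G.IsThreeEdgeConnected)
    (hV : V(G).Finite) {σ : β → ℤˣ} {x : α} {l : List (β × α)} (hc : G.IsCyc x l)
    (hs : walkSign σ l = -1) :
    ∃ y c, G.IsCyc y c ∧ walkSign σ c = -1 ∧
      ∀ u ∈ V(G), ∀ v ∈ V(G), G.Reach (E(G) \ {e | e ∈ walkEdges c}) u v := by
  obtain ⟨z, hz⟩ : V(G).Nonempty := by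
    obtain ⟨p, l, rfl⟩ := List.exists_cons_of_ne_nil hc.2.1
    exact ⟨x, hc.1.1.left_mem⟩
  induction hn : (V(G) \ G.comp V(G) {e | e ∈ walkEdges l} z).ncard using Nat.strong_induction_on
    generalizing x l with
  | _ n ih =>
  set X : Set β := {e | e ∈ walkEdges l} with hX
  have hMV : G.comp V(G) X z ⊆ V(G) := comp_subset hz
  by_cases hM : V(G) ⊆ G.comp V(G) X z
  · refine ⟨x, l, hc, hs, fun u hu v hv ↦ ?_⟩
    have hu' := hM hu
    have hv' := hM hv
    rw [comp, Set.mem_ofPred_eq, inside_vertexSet] at hu' hv'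
    exact hu'.symm.trans hv'
  have improve : ∀ {y : α} {w : List (β × α)}, G.IsWalk y w y → walkSign σ w = -1 →
      ∀ {S : Set α}, G.IsSide V(G) (G.comp V(G) X z) S →
      (∀ e ∈ walkEdges w, e ∈ X ∪ G.inside S) → ∀ g s m, G.IsLink g s m → s ∈ S → m ∉ S →
      g ∉ walkEdges w → ∃ y c, G.IsCyc y c ∧ walkSign σ c = -1 ∧
      ∀ u ∈ V(G), ∀ v ∈ V(G), G.Reach (E(G) \ {e | e ∈ walkEdges c}) u v := by
    intro y w hw hws S hS hwX g s m hg hsS hmS hgw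
    obtain ⟨y', c, hcc, hcw, hcs⟩ := hw.exists_isCyc hws
    refine ih _ ?_ hcc hcs rfl
    have hlt : G.comp V(G) X z ⊂ G.comp V(G) {e | e ∈ walkEdges c} z :=
      hS.comp_ssubset (fun e he ↦ hwX e (hcw e he)) hg hsS hmS
        (inside_vertexSet (G := G) ▸ hg.edge_mem) (fun he ↦ hgw (hcw _ he))
    rw [← hn]
    refine Set.ncard_lt_ncard ?_ (hV.sdiff)
    refine ⟨Set.sdiff_subset_sdiff_right hlt.1, fun hle ↦ hlt.2 fun v hv ↦ ?_⟩
    by_contra hvM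
    exact (hle ⟨comp_subset hz hv, hvM⟩).2 hv
  obtain ⟨v, hvV, hvM⟩ := Set.not_subset.1 hM
  -- A single edge leaving the component of `z` is enough, so the two excluded edges are arbitrary.
  -- The edge lies on the cycle, so the cycle can be rotated to start at its end `a`, which is
  -- outside `S`.
  obtain ⟨e, a, b, -, -, ha, hb, he⟩ := h3 _ hMV ⟨z, mem_comp_self _ _ _⟩ ⟨v, hvV, hvM⟩
    (l.head hc.2.1).1 (l.head hc.2.1).1
  have heX : e ∈ X := by
    by_contra heX
    exact hb.2 (he.mem_comp ha (inside_vertexSet (G := G) ▸ he.edge_mem) heX)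
  obtain ⟨l', hc', hl'⟩ := hc.rotate (hc.1.mem_support_of_inc heX he.inc_left)
  have hXl' : ∀ e, e ∈ walkEdges l' ↔ e ∈ X := fun e ↦ mem_walkEdges_perm hl'
  have hs' : walkSign σ l' = -1 := (walkSign_perm σ hl').trans hs
  obtain ⟨S, hS, hvS⟩ := exists_isSide (G := G) hvV hvM
  have haS : a ∉ S := Set.disjoint_left.1 hS.disjoint ha
  have hcut : ∀ e₁ e₂, ∃ e ∈ walkEdges l', G.Crosses S e ∧ e ≠ e₁ ∧ e ≠ e₂ := by
    intro e₁ e₂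
    obtain ⟨e, s, t, h₁, h₂, hsS, htS, hst⟩ := h3 S hS.subset hS.nonempty
      ⟨a, he.left_mem, haS⟩ e₁ e₂
    have hcr : G.Crosses S e := ⟨s, hsS, t, htS.2, hst⟩
    exact ⟨e, (hXl' e).2 (hS.mem_of_crosses (inside_vertexSet (G := G) ▸ hst.edge_mem) hcr), hcr,
      h₁, h₂⟩
  obtain ⟨e₁, h₁⟩ | ⟨l₁, g, m, l₂, l₃, s, t, rfl, hl₁, hsS, hg, hmS, hl₂, htS, hl₃⟩ |
    ⟨-, l₁, g, m, l₂, s, e₁, -, -, -, -, -, h₁⟩ := hc'.1.crossing_trichotomy S e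
  · obtain ⟨e', he', hcr, hne, -⟩ := hcut e₁ e₁
    exact absurd (h₁ e' he' hcr) hne
  · obtain ⟨q, hq, hqS⟩ := (hS.reach s hsS t htS).exists_isWalk
    have hnd := hc'.2.2.2
    simp only [walkEdges_append, walkEdges_cons] at hnd hXl'
    rw [List.nodup_append, List.nodup_cons] at hnd
    have hnq : ∀ g' s' m', G.IsLink g' s' m' → m' ∉ S → g' ∉ walkEdges q :=
      fun g' s' m' hg' hm' hgq ↦ hm' (hg'.mem_of_inside (hqS g' hgq)).2
    -- The excursion of the cycle from `s` to `t` outside `S` is closed up by the path `q` inside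
    -- `S`.
    have hcase : walkSign σ (l₁ ++ (q ++ l₃)) = -1 ∨
        walkSign σ (((g, m) :: l₂) ++ walkReverse s q) = -1 := by
      simp only [walkSign_append, walkSign_cons, walkSign_reverse] at hs' ⊢
      exact eq_neg_one_or_of_mul_eq_neg_one _ _ _ _ _ hs'
    obtain hneg | hneg := hcase
    · refine improve (hl₁.append (hq.append hl₃)) hneg hS ?_ g s m hg hsS hmS ?_
      · intro e' he'
        simp only [walkEdges_append, List.mem_append] at he'
        obtain he' | he' | he' := he'
        · exact Or.inl ((hXl' e').1 (by simp [he']))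
        · exact Or.inr (hqS e' he')
        · exact Or.inl ((hXl' e').1 (by simp [he']))
      · simp only [walkEdges_append, List.mem_append, not_or] at hnd ⊢
        refine ⟨fun hg₁ ↦ hnd.2.2 g hg₁ g (by simp) rfl, hnq g s m hg hmS, hnd.2.1.1.2⟩
    -- The kept excursion uses `g`, so another freed edge is needed: the one by which `l₁`, starting
    -- at `a` outside `S`, first enters `S`.
    · obtain hall | ⟨l₄, g', m', l₅, s', rfl, hl₄, hl₄S, hg', hm', hl₅⟩ :=
        hl₁.exists_exit (S := Sᶜ) haS
      · exact absurd hsS (hall s hl₁.end_mem_support)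
      refine improve (y := s) (IsWalk.append (l := (g, m) :: l₂) ⟨hg, hl₂⟩ hq.reverse)
        hneg hS ?_ g' m' s' hg'.symm (by simpa using hm') (hl₄S s' hl₄.end_mem_support) ?_
      · intro e' he'
        simp only [walkEdges_append, walkEdges_cons, walkEdges_reverse, List.mem_append,
          List.mem_reverse] at he'
        obtain he' | he' := he'
        · exact Or.inl ((hXl' e').1 (by simp only [List.mem_append, List.mem_cons] at he' ⊢; tauto))
        · exact Or.inr (hqS e' he')
      · simp only [walkEdges_append, walkEdges_cons, walkEdges_reverse, List.mem_append,
          List.mem_reverse, not_or]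
        refine ⟨fun hg₁ ↦ hnd.2.2 g' (by simp) g' ?_ rfl,
          hnq g' m' s' hg'.symm (hl₄S s' hl₄.end_mem_support)⟩
        simp only [List.mem_append, List.mem_cons] at hg₁ ⊢
        tauto
  · obtain ⟨e', he', hcr, hne, hne'⟩ := hcut e₁ g
    exact absurd (h₁ e' he' hcr) (by tauto)

/-! ### Nonseparating ears -/

/-- `T` is a nonempty set of vertices outside `U` with at most one edge leaving `T ∪ U` from
`T`. -/
def IsPod (G : Graph α β) (U T : Set α) : Prop :=
  T ⊆ V(G) \ U ∧ T.Nonempty ∧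
    ∃ e₁, ∀ e, ∀ x ∈ T, ∀ y ∈ (V(G) \ U) \ T, G.IsLink e x y → e = e₁

lemma exists_minimal_isPod (hV : V(G).Finite) {U : Set α} (hUV : (V(G) \ U).Nonempty) (e₀ : β) :
    ∃ B, Minimal (G.IsPod U) B := by
  have hfin : {T | G.IsPod U T}.Finite := hV.finite_subsets.subset
    fun T hT ↦ hT.1.trans Set.sdiff_subset
  obtain ⟨B, hB⟩ := hfin.exists_minimal
    ⟨V(G) \ U, subset_rfl, hUV, e₀, fun e x _ y hy ↦ absurd hy.1 hy.2⟩
  exact ⟨B, hB⟩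

/-- A component of the graph induced on `B` has no further edges into `B`, so it is again a pod, and
minimality makes it all of `B`. -/
lemma IsPod.reach {U B : Set α} (hB : Minimal (G.IsPod U) B) :
    ∀ u ∈ B, ∀ v ∈ B, G.Reach (G.inside B) u v := by
  intro u hu v hv
  have hsub : {w | G.Reach (G.inside B) u w} ⊆ B := fun w hw ↦
    Reach.mem_of_closed hw hu fun e he a _ b hab ↦ (hab.mem_of_inside he).2
  obtain ⟨e₁, he₁⟩ := hB.prop.2.2
  refine hB.le_of_le ⟨hsub.trans hB.prop.1, ⟨u, Reach.refl u⟩, e₁, fun e x hx y hy hxy ↦ ?_⟩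
    hsub hv
  refine he₁ e x (hsub hx) y ⟨hy.1, fun hyB ↦ hy.2 ?_⟩ hxy
  exact Reach.trans hx (hxy.reach (hxy.mem_inside (hsub hx) hyB))

/-- In a graph whose edge cuts have at least three edges, for every proper nonempty set `U` of
vertices there is a path outside `U`, with edges from its ends to `U`, that lies in a
subgraph from which its edges can be deleted without disconnecting it. -/
theorem IsThreeEdgeConnected.exists_nonseparating_isPath (h3 : G.IsThreeEdgeConnected)
    (hV : V(G).Finite) {U : Set α} (hU : (V(G) ∩ U).Nonempty) (hUV : (V(G) \ U).Nonempty)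
    (e₀ : β) :
    ∃ B ⊆ V(G) \ U, ∃ x ∈ B, ∃ x' ∈ U, ∃ y, ∃ y' ∈ U, ∃ e f l, G.IsLink e x x' ∧
      G.IsLink f y y' ∧ e ≠ f ∧ G.IsPath x l y ∧ (∀ g ∈ walkEdges l, g ∈ G.inside B) ∧
      ∀ u ∈ B, ∀ v ∈ B, G.Reach (G.inside B \ {g | g ∈ walkEdges l}) u v := by
  obtain ⟨B, hB⟩ := exists_minimal_isPod hV hUV e₀
  obtain ⟨hBU, ⟨b₀, hb₀⟩, ε, hε⟩ := hB.prop
  have hBV : B ⊆ V(G) := hBU.trans Set.sdiff_subset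
  obtain ⟨u₀, hu₀V, hu₀⟩ := hU
  -- `z` is the end in `B` of the only edge that may leave `B` outside `U`. A side `S` avoiding `z`
  -- therefore sends edges only to `B` and `U`.
  obtain ⟨z, hz, hzB⟩ : ∃ z ∈ B, ∀ e, ∀ x ∈ B, ∀ y ∈ (V(G) \ U) \ B, G.IsLink e x y → x = z := by
    by_cases hex : ∃ e, ∃ x ∈ B, ∃ y ∈ (V(G) \ U) \ B, G.IsLink e x y
    · obtain ⟨e, z, hz, y, hy, hzy⟩ := hex
      refine ⟨z, hz, fun e' x hx y' hy' hxy ↦ ?_⟩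
      rw [hε e z hz y hy hzy] at hzy
      rw [hε e' x hx y' hy' hxy] at hxy
      obtain ⟨h, -⟩ | ⟨h, -⟩ := hxy.eq_and_eq_or_eq_and_eq hzy
      · exact h
      · exact absurd (h ▸ hx) hy.2
    · push Not at hex
      exact ⟨b₀, hb₀, fun e x hx y hy hxy ↦ absurd hxy (hex e x hx y hy)⟩
  suffices key : ∀ x ∈ B, ∀ x' ∈ U, ∀ y, ∀ y' ∈ U, ∀ e f l, G.IsLink e x x' →
      G.IsLink f y y' → e ≠ f → G.IsPath x l y → (∀ g ∈ walkEdges l, g ∈ G.inside B) →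
      ∃ x ∈ B, ∃ x' ∈ U, ∃ y, ∃ y' ∈ U, ∃ e f l, G.IsLink e x x' ∧
        G.IsLink f y y' ∧ e ≠ f ∧ G.IsPath x l y ∧ (∀ g ∈ walkEdges l, g ∈ G.inside B) ∧
        ∀ u ∈ B, ∀ v ∈ B, G.Reach (G.inside B \ {g | g ∈ walkEdges l}) u v by
    have hcut : ∀ e₁, ∃ e, e ≠ e₁ ∧ ∃ x ∈ B, ∃ x' ∈ U, G.IsLink e x x' := by
      intro e₁
      obtain ⟨e, x, x', h₁, h₂, hx, hx', hxx'⟩ := h3 B hBV ⟨b₀, hb₀⟩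
        ⟨u₀, hu₀V, fun h ↦ (hBU h).2 hu₀⟩ ε e₁
      refine ⟨e, h₂, x, hx, x', ?_, hxx'⟩
      by_contra hU'
      exact h₁ (hε e x hx x' ⟨⟨hx'.1, hU'⟩, hx'.2⟩ hxx')
    obtain ⟨e, -, x, hx, x', hx', hxx'⟩ := hcut e₀
    obtain ⟨f, hfe, y, hy, y', hy', hyy'⟩ := hcut e
    obtain ⟨l, hl, hlB⟩ := (IsPod.reach hB x hx y hy).exists_isPath
    exact ⟨B, hBU, key x hx x' hx' y y' hy' e f l hxx' hyy' hfe.symm hl hlB⟩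
  intro x hx x' hx' y y' hy' e f l hxx' hyy' hef hl hlB
  induction hn : (B \ G.comp B {e | e ∈ walkEdges l} z).ncard using Nat.strong_induction_on
    generalizing x x' y y' e f l with
  | _ n ih =>
  set X : Set β := {e | e ∈ walkEdges l} with hX
  have hMB : G.comp B X z ⊆ B := comp_subset hz
  by_cases hM : B ⊆ G.comp B X z
  · exact ⟨x, hx, x', hx', y, y', hy', e, f, l, hxx', hyy', hef, hl, hlB,
      fun u hu v hv ↦ Reach.trans (Reach.symm (hM hu)) (hM hv)⟩
  obtain ⟨v, hvB, hvM⟩ := Set.not_subset.1 hM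
  obtain ⟨S, hS, hvS⟩ := exists_isSide (G := G) hvB hvM
  have hzS : z ∉ S := Set.disjoint_left.1 hS.disjoint (mem_comp_self _ _ _)
  -- The start `x` and its edge `e` stay fixed; only the path and its far end change.
  have improve : ∀ {w : List (β × α)} {t t' : α} {h : β}, G.IsWalk x w t → t' ∈ U →
      G.IsLink h t t' → e ≠ h → (∀ e ∈ walkEdges w, e ∈ X ∪ G.inside S) →
      ∀ g s m, G.IsLink g s m → s ∈ S → m ∉ S → g ∈ X → g ∉ walkEdges w →
      ∃ x ∈ B, ∃ x' ∈ U, ∃ y, ∃ y' ∈ U, ∃ e f l, G.IsLink e x x' ∧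
        G.IsLink f y y' ∧ e ≠ f ∧ G.IsPath x l y ∧ (∀ g ∈ walkEdges l, g ∈ G.inside B) ∧
        ∀ u ∈ B, ∀ v ∈ B, G.Reach (G.inside B \ {g | g ∈ walkEdges l}) u v := by
    intro w t t' h hw ht' hh heh hwX g s m hg hsS hmS hgX hgw
    obtain ⟨p, hp, hpw⟩ := (hw.reach (F := {e | e ∈ walkEdges w}) fun _ h ↦ h).exists_isPath
    refine ih _ ?_ x hx x' hx' t t' ht' e h p hxx' hh heh hp (fun g' hg' ↦ ?_) rfl
    · have hlt : G.comp B X z ⊂ G.comp B {e | e ∈ walkEdges p} z :=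
        hS.comp_ssubset (fun e he ↦ hwX e (hpw e he)) hg hsS hmS (hlB g hgX)
          (fun he ↦ hgw (hpw _ he))
      rw [← hn]
      refine Set.ncard_lt_ncard ?_ ((hV.subset hBV).sdiff)
      refine ⟨Set.sdiff_subset_sdiff_right hlt.1, fun hle ↦ hlt.2 fun v hv ↦ ?_⟩
      by_contra hvM
      exact (hle ⟨comp_subset hz hv, hvM⟩).2 hv
    · obtain h | h := hwX g' (hpw g' hg')
      · exact hlB g' h
      · exact inside_mono hS.subset h
  -- Otherwise `S` would be a pod properly inside the minimal `B`, since it misses `z`.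
  have hnpod : ∀ e₁, ∃ g ∈ X, G.Crosses S g ∧ g ≠ e₁ := by
    intro e₁
    by_contra! hcon
    have hpod : G.IsPod U S := by
      refine ⟨hS.subset.trans hBU, hS.nonempty, e₁, fun g a ha b hb hab ↦ ?_⟩
      by_cases hbB : b ∈ B
      · have hcr : G.Crosses S g := ⟨a, ha, b, hb.2, hab⟩
        exact hcon g (hS.mem_of_crosses (hab.mem_inside (hS.subset ha) hbB) hcr) hcr
      · exact absurd ha (hzB g a (hS.subset ha) b ⟨hb.1, hbB⟩ hab ▸ hzS)
    exact hzS (hB.le_of_le hpod hS.subset hz)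
  obtain ⟨e₁, h₁⟩ | ⟨l₁, g, m, l₂, l₃, s, t, rfl, hl₁, hsS, hg, hmS, hl₂, htS, hl₃⟩ |
    ⟨hxS, l₁, g, m, l₂, s, e₁, rfl, hl₁, hsS, hg, hmS, h₁⟩ := hl.1.crossing_trichotomy S e₀
  · obtain ⟨g, hg, hcr, hne⟩ := hnpod e₁
    exact absurd (h₁ g hg hcr) hne
  · obtain ⟨q, hq, hqS⟩ := (hS.reach s hsS t htS).exists_isWalk
    have hnd := hl.1.nodup_walkEdges hl.2
    simp only [walkEdges_append, walkEdges_cons] at hnd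
    rw [List.nodup_append, List.nodup_cons] at hnd
    refine improve (hl₁.append (hq.append hl₃)) hy' hyy' hef ?_ g s m hg hsS hmS (by simp [hX]) ?_
    · intro e' he'
      simp only [walkEdges_append, List.mem_append] at he'
      obtain he' | he' | he' := he'
      · exact Or.inl (by simp [hX, he'])
      · exact Or.inr (hqS e' he')
      · exact Or.inl (by simp [hX, he'])
    · simp only [walkEdges_append, List.mem_append, not_or] at hnd ⊢
      exact ⟨fun hg₁ ↦ hnd.2.2 g hg₁ g (by simp) rfl,
        fun hgq ↦ hmS (hg.mem_of_inside (hqS g hgq)).2, hnd.2.1.1.2⟩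
  -- The path crosses the boundary of `S` only in `e₁` and `g`, so a third edge `h` of the cut must
  -- go to `U`. The path is cut short inside `S` and leaves through `h`, which frees `g`.
  · obtain ⟨h, w, w', hh₁, hhg, hw, hw', hww'⟩ := h3 S (hS.subset.trans hBV) hS.nonempty
      ⟨z, hBV hz, hzS⟩ e₁ g
    have hwB := hS.subset hw
    have hw'B : w' ∉ B := by
      intro hw'B
      have hcr : G.Crosses S h := ⟨w, hw, w', hw'.2, hww'⟩
      have := h₁ h (hS.mem_of_crosses (hww'.mem_inside hwB hw'B) hcr) hcr
      tauto
    have hw'U : w' ∈ U := by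
      by_contra hw'U
      exact hzS (hzB h w hwB w' ⟨⟨hw'.1, hw'U⟩, hw'B⟩ hww' ▸ hw)
    have heh : e ≠ h := by
      rintro rfl
      obtain ⟨rfl, -⟩ | ⟨rfl, -⟩ := hxx'.eq_and_eq_or_eq_and_eq hww'
      · exact hxS hw
      · exact hw'B hx
    obtain ⟨q, hq, hqS⟩ := (hS.reach s hsS w hw).exists_isWalk
    have hnd := hl.1.nodup_walkEdges hl.2
    simp only [walkEdges_append, walkEdges_cons] at hnd
    rw [List.nodup_append, List.nodup_cons] at hnd
    refine improve (hl₁.append hq) hw'U hww' heh ?_ g s m hg hsS hmS (by simp [hX]) ?_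
    · intro e' he'
      simp only [walkEdges_append, List.mem_append] at he'
      obtain he' | he' := he'
      · exact Or.inl (by simp [hX, he'])
      · exact Or.inr (hqS e' he')
    · simp only [walkEdges_append, List.mem_append, not_or] at hnd ⊢
      exact ⟨fun hg₁ ↦ hnd.2.2 g hg₁ g (by simp) rfl,
        fun hgq ↦ hmS (hg.mem_of_inside (hqS g hgq)).2⟩

/-! ### Path operations and passage to cycle edge sets -/

lemma IsPath.reverse {x y : α} {l : List (β × α)} (h : G.IsPath x l y) :
    G.IsPath y (walkReverse x l) x :=
  ⟨h.1.reverse, by rw [h.1.support_reverse]; exact List.nodup_reverse.2 h.2⟩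

lemma IsPath.append_cons {x y y' z : α} {f : β} {l q : List (β × α)} (hl : G.IsPath x l y)
    (hf : G.IsLink f y y') (hq : G.IsPath y' q z) (hd : ∀ v ∈ support x l, v ∉ support y' q) :
    G.IsPath x (l ++ (f, y') :: q) z := by
  refine ⟨hl.1.append ⟨hf, hq.1⟩, ?_⟩
  have : support x (l ++ (f, y') :: q) = support x l ++ support y' q := by simp [support]
  rw [this, List.nodup_append]
  exact ⟨hl.2, hq.2, fun a ha b hb hab ↦ hd a ha (hab ▸ hb)⟩

lemma IsWalk.exists_inc_end {x y : α} {l : List (β × α)} (h : G.IsWalk x l y) (hl : l ≠ []) :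
    ∃ e ∈ walkEdges l, G.Inc e y := by
  induction l generalizing x with
  | nil => exact absurd rfl hl
  | cons p l ih =>
    cases l with
    | nil =>
      obtain rfl : p.2 = y := h.2
      exact ⟨p.1, by simp, h.1.inc_right⟩
    | cons q l =>
      obtain ⟨e, he, hy⟩ := ih h.2 (by simp)
      exact ⟨e, by rw [walkEdges_cons]; exact List.mem_cons_of_mem _ he, hy⟩

lemma IsWalk.exists_inc_start {x y : α} {l : List (β × α)} (h : G.IsWalk x l y) (hl : l ≠ []) :
    ∃ e ∈ walkEdges l, G.Inc e x := by
  obtain ⟨p, l, rfl⟩ := List.exists_cons_of_ne_nil hl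
  exact ⟨p.1, by simp, h.1.inc_left⟩

lemma IsWalk.isLink_getElem {x y : α} {l : List (β × α)} (h : G.IsWalk x l y) {i : ℕ}
    (hi : i < l.length) :
    G.IsLink l[i].1 ((support x l)[i]'(by simp [support]; omega)) l[i].2 := by
  induction l generalizing x i with
  | nil => simp at hi
  | cons p l ih =>
    cases i with
    | zero => exact h.1
    | succ i => exact ih h.2 (by simpa using hi)

lemma IsWalk.getElem_support_length {x y : α} {l : List (β × α)} (h : G.IsWalk x l y) :
    (support x l)[l.length]'(by simp [support]) = y := by
  induction l generalizing x with
  | nil => exact h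
  | cons p l ih => exact ih h.2

lemma IsCyc.isCycleEdgeSet {x : α} {l : List (β × α)} (h : G.IsCyc x l) :
    G.IsCycleEdgeSet {e | e ∈ walkEdges l} := by
  obtain ⟨n, hn⟩ : ∃ n, l.length = n + 1 :=
    Nat.exists_eq_succ_of_ne_zero (by simpa using h.2.1)
  have hlt : ∀ i : Fin (n + 1), (i : ℕ) < l.length := fun i ↦ by omega
  -- A list entry stores the head of its edge, so the tail of edge `i` is read from entry `i - 1`;
  -- cyclically, entry `n` supplies the starting vertex.
  refine ⟨n, fun i ↦ (l[((i - 1 : Fin (n + 1)) : ℕ)]'(hlt _)).2, fun i ↦ (l[(i : ℕ)]'(hlt _)).1,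
    ?_, ?_, ?_, ?_⟩
  · intro i j hij
    have := (List.Nodup.getElem_inj_iff h.2.2.1 (i := ((i - 1 : Fin (n + 1)) : ℕ))
      (j := ((j - 1 : Fin (n + 1)) : ℕ)) (hi := by simpa using hlt _)
      (hj := by simpa using hlt _)).1 (by simpa using hij)
    exact sub_left_injective (Fin.ext this)
  · intro i j hij
    exact Fin.ext ((List.Nodup.getElem_inj_iff h.2.2.2 (hi := by simpa [walkEdges] using hlt i)
      (hj := by simpa [walkEdges] using hlt j)).1 (by simpa [walkEdges] using hij))
  · intro i
    simp only [add_sub_cancel_right]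
    have hl := h.1.isLink_getElem (hlt i)
    convert hl using 1
    cases i using Fin.cases with
    | zero =>
      have hlast : ((0 - 1 : Fin (n + 1)) : ℕ) = n := by simp [Fin.coe_neg_one]
      have hx := h.1.getElem_support_length
      simp only [hn, support, List.getElem_cons_succ, List.getElem_map] at hx
      refine Eq.trans ?_ (show x = _ from rfl)
      simpa only [hlast] using hx
    | succ j =>
      have hj : ((j.succ - 1 : Fin (n + 1)) : ℕ) = j := by
        rw [Fin.coe_sub_one, if_neg (Fin.succ_ne_zero j), Fin.val_succ, Nat.add_sub_cancel]
      have hjl : (j : ℕ) < (l.map Prod.snd).length := by rw [List.length_map, hn]; omega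
      refine Eq.trans ?_ (show (l.map Prod.snd)[(j : ℕ)] = _ from rfl)
      simp only [hj, List.getElem_map]
  · ext e
    simp only [walkEdges, List.mem_map, Set.mem_ofPred_eq, Set.mem_range]
    constructor
    · rintro ⟨p, hp, rfl⟩
      obtain ⟨i, hi, rfl⟩ := List.mem_iff_getElem.1 hp
      exact ⟨⟨i, hn ▸ hi⟩, rfl⟩
    · rintro ⟨i, rfl⟩
      exact ⟨_, List.getElem_mem _, rfl⟩

lemma IsCyc.finprod_eq {x : α} {l : List (β × α)} (h : G.IsCyc x l) (σ : β → ℤˣ) :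
    ∏ᶠ e ∈ {e | e ∈ walkEdges l}, σ e = walkSign σ l := by
  classical
  have : {e | e ∈ walkEdges l} = ((walkEdges l).toFinset : Set β) := by ext; simp
  rw [this, finprod_mem_coe_finset, List.prod_toFinset _ h.2.2.2, walkEdges, List.map_map]
  rfl

/-- In a `2`-closed set, a positive cycle with at most two edges outside the set has none. -/
lemma IsKClosed.mem_of_isCyc {σ : β → ℤˣ} {Z : Set β} (hZ : G.IsKClosed σ 2 Z) {x : α}
    {l : List (β × α)} (hc : G.IsCyc x l) (hs : walkSign σ l = 1) {a b : β}
    (h : ∀ e ∈ walkEdges l, e ∈ Z ∨ e = a ∨ e = b) : ∀ e ∈ walkEdges l, e ∈ Z := by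
  by_contra! hcon
  obtain ⟨e, he, heZ⟩ := hcon
  refine hZ ⟨{e | e ∈ walkEdges l}, ⟨hc.isCycleEdgeSet, (hc.finprod_eq σ).trans hs⟩,
    Set.one_le_encard_iff_nonempty.2 ⟨e, he, heZ⟩, ?_⟩
  have hsub : {e | e ∈ walkEdges l} \ Z ⊆ {a, b} := fun g hg ↦ (h g hg.1).resolve_left hg.2
  refine (Set.encard_le_encard hsub).trans ((Set.encard_insert_le _ _).trans ?_)
  rw [Set.encard_singleton]
  norm_num

/-! ### Linked sets and their extension by ears -/

/-- There is a path of sign `s` (of any sign, if `bal` holds) from `u` to `v` with vertices in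
`W` and edges in `Z`. -/
def HasPath (G : Graph α β) (σ : β → ℤˣ) (bal : Prop) (W : Set α) (Z : Set β) (u v : α)
    (s : ℤˣ) : Prop :=
  ∃ l, G.IsPath u l v ∧ (∀ w ∈ support u l, w ∈ W) ∧ (∀ e ∈ walkEdges l, e ∈ Z) ∧
    (bal ∨ walkSign σ l = s)

/-- Any two vertices of `W` are joined in `W` by paths of both signs (of any sign, if `bal`
holds) with edges in `Z`. -/
def IsLinked (G : Graph α β) (σ : β → ℤˣ) (bal : Prop) (W : Set α) (Z : Set β) : Prop :=
  ∀ u ∈ W, ∀ v ∈ W, u ≠ v → ∀ s, G.HasPath σ bal W Z u v s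

lemma HasPath.symm {σ : β → ℤˣ} {bal : Prop} {W : Set α} {Z : Set β} {u v : α} {s : ℤˣ}
    (h : G.HasPath σ bal W Z u v s) : G.HasPath σ bal W Z v u s := by
  obtain ⟨l, hl, hW, hZ, hs⟩ := h
  refine ⟨walkReverse u l, hl.reverse, ?_, ?_, by simpa using hs⟩
  · simpa [hl.1.support_reverse] using hW
  · simpa [walkEdges_reverse] using hZ

lemma HasPath.mono {σ : β → ℤˣ} {bal : Prop} {W W' : Set α} {Z : Set β} {u v : α} {s : ℤˣ}
    (h : G.HasPath σ bal W Z u v s) (hW : W ⊆ W') : G.HasPath σ bal W' Z u v s := by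
  obtain ⟨l, hl, hlW, hZ, hs⟩ := h
  exact ⟨l, hl, fun w hw ↦ hW (hlW w hw), hZ, hs⟩

lemma IsPath.hasPath_append {σ : β → ℤˣ} {bal : Prop} {T W : Set α} {Z : Set β} {u w w' v : α}
    {g : β} {p : List (β × α)} (hp : G.IsPath u p w) (hpT : ∀ a ∈ support u p, a ∈ T)
    (hpZ : ∀ e ∈ walkEdges p, e ∈ Z) (hg : G.IsLink g w w') (hgZ : g ∈ Z) (hTW : Disjoint T W)
    (h : ∀ s, G.HasPath σ bal W Z w' v s) (s : ℤˣ) : G.HasPath σ bal (T ∪ W) Z u v s := by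
  -- Signs are their own inverses, so this choice gives total sign `s`.
  obtain ⟨q, hq, hqW, hqZ, hqs⟩ := h (σ g * walkSign σ p * s)
  have hsup : support u (p ++ (g, w') :: q) = support u p ++ support w' q := by simp [support]
  refine ⟨p ++ (g, w') :: q, hp.append_cons hg hq fun a ha ha' ↦
    Set.disjoint_left.1 hTW (hpT a ha) (hqW a ha'), ?_, ?_, ?_⟩
  · rw [hsup]
    intro a ha
    obtain ha | ha := List.mem_append.1 ha
    exacts [Or.inl (hpT a ha), Or.inr (hqW a ha)]
  · simp only [walkEdges_append, walkEdges_cons, List.mem_append, List.mem_cons]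
    rintro e (he | rfl | he)
    exacts [hpZ e he, hgZ, hqZ e he]
  · refine hqs.imp_right fun hqs ↦ ?_
    rw [walkSign_append, walkSign_cons, hqs]
    calc walkSign σ p * (σ g * (σ g * walkSign σ p * s))
        = (walkSign σ p * walkSign σ p) * (σ g * σ g) * s := by
          simp only [mul_comm, mul_left_comm]
      _ = s := by rw [Int.units_mul_self, Int.units_mul_self, one_mul, one_mul]

/-- A path from `v` to `u` of sign `σ e` closes `e` to a positive cycle with no other edge outside
`Z`. -/
lemma IsLinked.mem_of_isLink {σ : β → ℤˣ} {bal : Prop} {W : Set α} {Z : Set β}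
    (h : G.IsLinked σ bal W Z) (hbal : bal → ∀ x l, G.IsCyc x l → walkSign σ l = 1)
    (hZ : G.IsKClosed σ 2 Z) {e : β} {u v : α} (he : G.IsLink e u v) (hu : u ∈ W) (hv : v ∈ W)
    (huv : u ≠ v) : e ∈ Z := by
  by_contra heZ
  obtain ⟨l, hl, -, hlZ, hs⟩ := h v hv u hu huv.symm (σ e)
  have hc := hl.isCyc_cons he fun hel ↦ heZ (hlZ e hel)
  refine heZ (hZ.mem_of_isCyc hc ?_ (a := e) (b := e) ?_ e (by simp))
  · obtain hb | hs := hs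
    · exact hbal hb _ _ hc
    · rw [walkSign_cons, hs, Int.units_mul_self]
  · simp only [walkEdges_cons, List.mem_cons]
    rintro g (rfl | hg)
    exacts [Or.inr (Or.inl rfl), Or.inl (hlZ g hg)]

/-- The return path through `U` is chosen with the sign of the whole ear; the resulting positive
cycle has at most the two edges `e`, `f` outside `Z`, which is why k = 2 is needed. -/
lemma IsLinked.mem_of_ear {σ : β → ℤˣ} {bal : Prop} {U : Set α} {Z : Set β}
    (h : G.IsLinked σ bal U Z) (hbal : bal → ∀ x l, G.IsCyc x l → walkSign σ l = 1)
    (hZ : G.IsKClosed σ 2 Z) {x x' y y' : α} {e f : β} {l : List (β × α)}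
    (hl : G.IsPath x l y) (hlU : ∀ v ∈ support x l, v ∉ U) (hlZ : ∀ g ∈ walkEdges l, g ∈ Z)
    (he : G.IsLink e x x') (hf : G.IsLink f y y') (hx' : x' ∈ U) (hy' : y' ∈ U)
    (hne : x' ≠ y') : e ∈ Z ∧ f ∈ Z := by
  obtain ⟨q, hq, hqU, hqZ, hqs⟩ := h y' hy' x' hx' hne.symm (σ e * walkSign σ l * σ f)
  have hp := hl.append_cons hf hq fun v hv hv' ↦ hlU v hv (hqU v hv')
  have hep : e ∉ walkEdges (l ++ (f, y') :: q) := by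
    simp only [walkEdges_append, walkEdges_cons, List.mem_append, List.mem_cons, not_or]
    refine ⟨fun hel ↦ hlU _ (hl.1.mem_support_of_inc hel he.inc_right) hx', ?_,
      fun heq ↦ hlU x (mem_support_self _ _) (hqU x (hq.1.mem_support_of_inc heq he.inc_left))⟩
    rintro rfl
    obtain ⟨-, h⟩ | ⟨-, rfl⟩ := he.eq_and_eq_or_eq_and_eq hf
    · exact hne h
    · exact hlU x' hl.1.end_mem_support hx'
  have hc := hp.isCyc_cons he.symm hep
  have hall := hZ.mem_of_isCyc hc ?_ (a := e) (b := f) ?_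
  · exact ⟨hall e (by simp), hall f (by simp)⟩
  · obtain hb | hs := hqs
    · exact hbal hb _ _ hc
    · rw [walkSign_cons, walkSign_append, walkSign_cons, hs]
      calc σ e * (walkSign σ l * (σ f * (σ e * walkSign σ l * σ f)))
          = (σ e * σ e) * (walkSign σ l * walkSign σ l) * (σ f * σ f) := by
            simp only [mul_comm, mul_left_comm]
        _ = 1 := by simp only [Int.units_mul_self, one_mul]
  · simp only [walkEdges_append, walkEdges_cons, List.mem_append, List.mem_cons]
    rintro g (rfl | hg | rfl | hg)
    exacts [Or.inr (Or.inl rfl), Or.inl (hlZ g hg), Or.inr (Or.inr rfl), Or.inl (hqZ g hg)]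

/-- Every new connection is routed through two distinct vertices of `U`, where the sign can be
chosen freely. -/
lemma IsLinked.union_ear {σ : β → ℤˣ} {bal : Prop} {U : Set α} {Z : Set β}
    (h : G.IsLinked σ bal U Z) {x x' y y' : α} {e f : β} {l : List (β × α)}
    (hl : G.IsPath x l y) (hlU : ∀ v ∈ support x l, v ∉ U) (hlZ : ∀ g ∈ walkEdges l, g ∈ Z)
    (he : G.IsLink e x x') (hf : G.IsLink f y y') (hx' : x' ∈ U) (hy' : y' ∈ U)
    (hne : x' ≠ y') (heZ : e ∈ Z) (hfZ : f ∈ Z) :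
    G.IsLinked σ bal ({v | v ∈ support x l} ∪ U) Z := by
  have hdis : ∀ {u : α} {m : List (β × α)}, (∀ v ∈ support u m, v ∈ support x l) →
      Disjoint {v | v ∈ support u m} U := fun hm ↦
    Set.disjoint_left.2 fun v hv ↦ hlU v (hm v hv)
  -- Two ear vertices are joined the long way round, over both ends of the ear and through `U`; the
  -- segment between them has a fixed sign.
  have ordered : ∀ u v la lc ld, l = la ++ (lc ++ ld) → G.IsWalk x la u → G.IsWalk u lc v →
      G.IsWalk v ld y → u ≠ v → ∀ s, G.HasPath σ bal ({v | v ∈ support x l} ∪ U) Z v u s := by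
    rintro u v la lc ld rfl hla hlc hld huv s
    have hnd := hl.2
    simp only [support_append, List.map_append] at hnd
    rw [List.nodup_append, List.nodup_append] at hnd
    have hv : v ∈ lc.map Prod.snd := (List.mem_cons.1 hlc.end_mem_support).resolve_left huv.symm
    have hsa : ∀ w ∈ support x la, w ∈ support x (la ++ (lc ++ ld)) := fun w hw ↦ by
      rw [support_append]
      exact List.mem_append_left _ hw
    have hsd : ∀ w ∈ support v ld, w ∈ lc.map Prod.snd ∨ w ∈ ld.map Prod.snd := fun w hw ↦ by
      obtain rfl | hw := List.mem_cons.1 hw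
      exacts [Or.inl hv, Or.inr hw]
    have hsd' : ∀ w ∈ support v ld, w ∈ support x (la ++ (lc ++ ld)) := fun w hw ↦ by
      rw [support_append, List.map_append]
      exact List.mem_append_right _ (List.mem_append.2 (hsd w hw))
    have hpa : G.IsPath u (walkReverse x la) x := IsPath.reverse ⟨hla, hnd.1⟩
    have hpd : G.IsPath v ld y := by
      refine ⟨hld, List.nodup_cons.2 ⟨fun hvd ↦ hnd.2.1.2.2 v hv v hvd rfl, hnd.2.1.2.1⟩⟩
    simp only [walkEdges_append, List.mem_append] at hlZ
    have h₁ : ∀ s, G.HasPath σ bal ({w | w ∈ support x la} ∪ U) Z u y' s :=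
      hpa.hasPath_append (fun w hw ↦ by simpa [hla.support_reverse] using hw)
        (fun g hg ↦ hlZ g (Or.inl (by simpa [walkEdges_reverse] using hg))) he heZ (hdis hsa)
        (h x' hx' y' hy' hne)
    have h₂ : G.HasPath σ bal ({w | w ∈ support v ld} ∪ ({w | w ∈ support x la} ∪ U)) Z v u s := by
      refine hpd.hasPath_append (fun w hw ↦ hw) (fun g hg ↦ hlZ g (by simp [hg])) hf hfZ
        (Set.disjoint_union_right.2 ⟨?_, hdis hsd'⟩) (fun s ↦ (h₁ s).symm) s
      exact Set.disjoint_left.2 fun w hw hwa ↦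
        hnd.2.2 w hwa w (List.mem_append.2 (hsd w hw)) rfl
    refine h₂.mono (Set.union_subset (fun w hw ↦ Or.inl (hsd' w hw))
      (Set.union_subset_union_left _ hsa))
  -- The ear is left at an end whose attachment differs from `v`, because linkage concerns distinct
  -- vertices only.
  have mixed : ∀ u ∈ support x l, ∀ v ∈ U, ∀ s,
      G.HasPath σ bal ({v | v ∈ support x l} ∪ U) Z u v s := by
    intro u hu v hv s
    obtain ⟨la, lb, rfl, hla, hlb⟩ := hl.1.exists_append_of_mem hu
    have hnd := hl.2
    simp only [support_append] at hnd
    rw [List.nodup_append] at hnd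
    simp only [walkEdges_append, List.mem_append] at hlZ
    by_cases hv' : x' = v
    · have hpb : G.IsPath u lb y :=
        ⟨hlb, List.nodup_cons.2 ⟨fun h ↦ hnd.2.2 u hla.end_mem_support u h rfl, hnd.2.1⟩⟩
      have hsb : ∀ w ∈ support u lb, w ∈ support x (la ++ lb) := fun w hw ↦ by
        obtain rfl | hw := List.mem_cons.1 hw
        · exact hu
        · rw [support_append]
          exact List.mem_append_right _ hw
      refine (hpb.hasPath_append (fun w hw ↦ hw) (fun g hg ↦ hlZ g (Or.inr hg)) hf hfZ (hdis hsb)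
        (h y' hy' v hv (fun h ↦ hne (hv'.trans h.symm))) s).mono
        (Set.union_subset_union_left _ hsb)
    · have hpa : G.IsPath u (walkReverse x la) x := IsPath.reverse ⟨hla, hnd.1⟩
      have hsa : ∀ w ∈ support x la, w ∈ support x (la ++ lb) := fun w hw ↦ by
        rw [support_append]
        exact List.mem_append_left _ hw
      refine (hpa.hasPath_append (T := {w | w ∈ support x la})
        (fun w hw ↦ by simpa [hla.support_reverse] using hw)
        (fun g hg ↦ hlZ g (Or.inl (by simpa [walkEdges_reverse] using hg))) he heZ (hdis hsa)
        (h x' hx' v hv hv') s).mono (Set.union_subset_union_left _ hsa)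
  rintro u (hu | hu) v (hv | hv) huv s
  · obtain ⟨la, lb, hlab, hla, hlb⟩ := hl.1.exists_append_of_mem hu
    rw [Set.mem_ofPred_eq, hlab, support_append, List.mem_append] at hv
    obtain hv | hv := hv
    · obtain ⟨l₁, l₂, rfl, h₁, h₂⟩ := hla.exists_append_of_mem hv
      exact ordered v u l₁ l₂ lb (by simp [hlab]) h₁ h₂ hlb huv.symm s
    · obtain ⟨l₁, l₂, rfl, h₁, h₂⟩ := hlb.exists_append_of_mem (List.mem_cons_of_mem _ hv)
      exact (ordered u v la l₁ l₂ hlab hla h₁ h₂ huv s).symm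
  · exact mixed u hu v hv s
  · exact (mixed v hv u hu s).symm
  · exact (h u hu v hv huv s).mono Set.subset_union_right

/-- The two arcs between distinct vertices of a negative cycle have opposite signs; in the balanced
case either arc will do. -/
lemma IsCyc.isLinked {σ : β → ℤˣ} {bal : Prop} {x : α} {c : List (β × α)} (h : G.IsCyc x c)
    (hs : bal ∨ walkSign σ c = -1) {Z : Set β} (hZ : ∀ e ∈ walkEdges c, e ∈ Z) :
    G.IsLinked σ bal {v | v ∈ support x c} Z := by
  have hsup : ∀ {y : α} {c : List (β × α)}, G.IsCyc y c → ∀ w, w ∈ support y c ↔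
      w ∈ c.map Prod.snd := by
    intro y c h w
    refine ⟨fun hw ↦ ?_, fun hw ↦ List.mem_cons_of_mem _ hw⟩
    obtain rfl | hw := List.mem_cons.1 hw
    · obtain ⟨p, c, rfl⟩ := List.exists_cons_of_ne_nil h.2.1
      exact h.1.2.end_mem_support
    · exact hw
  intro u hu v hv huv s
  obtain ⟨l, hl, hlc⟩ := h.rotate hu
  have hsupl : ∀ w ∈ l.map Prod.snd, w ∈ support x c := fun w hw ↦
    (hsup h w).2 ((hlc.map _).mem_iff.1 hw)
  have hvl : v ∈ support u l := (hsup hl v).2 ((hlc.map _).mem_iff.2 ((hsup h v).1 hv))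
  obtain ⟨l₁, l₂, rfl, h₁, h₂⟩ := hl.1.exists_append_of_mem hvl
  have hnd := hl.2.2.1
  simp only [List.map_append] at hnd hsupl
  rw [List.nodup_append] at hnd
  have hv₁ : v ∈ l₁.map Prod.snd := (List.mem_cons.1 h₁.end_mem_support).resolve_left huv.symm
  have hu₂ : u ∈ l₂.map Prod.snd := (List.mem_cons.1 h₂.end_mem_support).resolve_left huv
  have hp₁ : G.IsPath u l₁ v :=
    ⟨h₁, List.nodup_cons.2 ⟨fun hu ↦ hnd.2.2 u hu u hu₂ rfl, hnd.1⟩⟩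
  have hp₂ : G.IsPath v l₂ u :=
    ⟨h₂, List.nodup_cons.2 ⟨fun hv ↦ hnd.2.2 v hv₁ v hv rfl, hnd.2.1⟩⟩
  have hZ' : ∀ e ∈ walkEdges (l₁ ++ l₂), e ∈ Z := fun e he ↦ hZ e ((mem_walkEdges_perm hlc).1 he)
  simp only [walkEdges_append, List.mem_append] at hZ'
  have r₁ : (bal ∨ walkSign σ l₁ = s) →
      G.HasPath σ bal {v | v ∈ support x c} Z u v s := fun hs ↦ by
    refine ⟨l₁, hp₁, fun w hw ↦ ?_, fun e he ↦ hZ' e (Or.inl he), hs⟩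
    obtain rfl | hw := List.mem_cons.1 hw
    · exact hu
    · exact hsupl w (List.mem_append_left _ hw)
  have r₂ : walkSign σ l₂ = s → G.HasPath σ bal {v | v ∈ support x c} Z u v s := fun hs ↦ by
    refine HasPath.symm ⟨l₂, hp₂, fun w hw ↦ ?_, fun e he ↦ hZ' e (Or.inr he), Or.inr hs⟩
    obtain rfl | hw := List.mem_cons.1 hw
    · exact hv
    · exact hsupl w (List.mem_append_right _ hw)
  obtain hb | hs := hs
  · exact r₁ (Or.inl hb)
  rw [← walkSign_perm σ hlc, walkSign_append] at hs
  have hcase : ∀ a b s : ℤˣ, a * b = -1 → a = s ∨ b = s := by decide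
  obtain hcase | hcase := hcase _ _ s hs
  exacts [r₁ (Or.inr hcase), r₂ hcase]

/-! ### Stages of the construction -/

/-- A stage of the construction of a `2`-base: the edges of `X` lie inside `U`, deleting them
does not disconnect `G`, and every `2`-closed set containing `X` links `U`. -/
structure IsStage (G : Graph α β) (σ : β → ℤˣ) (bal : Prop) (U : Set α) (X : Set β) : Prop where
  subset : U ⊆ V(G)
  nonempty : U.Nonempty
  subset_inside : X ⊆ G.inside U
  reach : ∀ u ∈ V(G), ∀ v ∈ V(G), G.Reach (E(G) \ X) u v
  two_edges : ∀ u ∈ U, ∃ e₁ ∈ G.inside U, ∃ e₂ ∈ G.inside U, e₁ ≠ e₂ ∧ G.Inc e₁ u ∧ G.Inc e₂ u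
  linked : ∀ Z, G.IsKClosed σ 2 Z → X ⊆ Z → G.IsLinked σ bal U Z

lemma IsCyc.isStage {σ : β → ℤˣ} {bal : Prop} {x : α} {c : List (β × α)} (h : G.IsCyc x c)
    (hloop : ∀ e v, ¬ G.IsLink e v v) (hs : bal ∨ walkSign σ c = -1)
    (hc : ∀ u ∈ V(G), ∀ v ∈ V(G), G.Reach (E(G) \ {e | e ∈ walkEdges c}) u v) :
    G.IsStage σ bal {v | v ∈ support x c} {e | e ∈ walkEdges c} := by
  have hsub : {e | e ∈ walkEdges c} ⊆ G.inside {v | v ∈ support x c} := by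
    intro e he
    obtain ⟨a, ha, b, hb, hab⟩ := h.1.exists_link_of_mem he
    exact ⟨a, ha, b, hb, hab⟩
  have htwo : ∀ u ∈ support x c, ∃ e₁ ∈ walkEdges c, ∃ e₂ ∈ walkEdges c, e₁ ≠ e₂ ∧
      G.Inc e₁ u ∧ G.Inc e₂ u := by
    intro u hu
    obtain ⟨l, hl, hlc⟩ := h.rotate hu
    obtain ⟨p, l, rfl⟩ := List.exists_cons_of_ne_nil hl.2.1
    have hne : l ≠ [] := by
      rintro rfl
      have hp : p.2 = u := hl.1.2
      exact hloop p.1 u (hp ▸ hl.1.1)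
    obtain ⟨e, he, heu⟩ := IsWalk.exists_inc_end hl.1.2 hne
    have hnd := hl.2.2.2
    rw [walkEdges_cons, List.nodup_cons] at hnd
    refine ⟨p.1, (mem_walkEdges_perm hlc).1 (by simp), e, (mem_walkEdges_perm hlc).1 (by simp [he]),
      fun hpe ↦ hnd.1 (hpe ▸ he), hl.1.1.inc_left, heu⟩
  refine ⟨fun v hv ↦ ?_, ⟨x, mem_support_self _ _⟩, hsub, hc, fun u hu ↦ ?_,
    fun Z _ hZ ↦ h.isLinked hs fun e he ↦ hZ he⟩
  · obtain ⟨e, -, -, -, -, he, -⟩ := htwo v hv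
    exact he.vertex_mem
  · obtain ⟨e₁, h₁, e₂, h₂, h⟩ := htwo u hu
    exact ⟨e₁, hsub h₁, e₂, hsub h₂, h⟩

lemma IsStage.exists_larger {σ : β → ℤˣ} {bal : Prop} {U : Set α} {X : Set β}
    (h : G.IsStage σ bal U X) (hbal : bal → ∀ x l, G.IsCyc x l → walkSign σ l = 1)
    (h3 : G.IsThreeEdgeConnected) (hcubic : G.IsCubic) (hV : V(G).Finite)
    (hUV : (V(G) \ U).Nonempty) : ∃ U' X', G.IsStage σ bal U' X' ∧ U ⊂ U' := by
  obtain ⟨u₀, hu₀⟩ := h.nonempty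
  obtain ⟨e₀, -⟩ := h.two_edges u₀ hu₀
  obtain ⟨B, hBU, x, hxB, x', hx', y, y', hy', e, f, l, he, hf, hef, hl, hlB, hBl⟩ :=
    h3.exists_nonseparating_isPath hV ⟨u₀, h.subset hu₀, hu₀⟩ hUV e₀
  have hsB : ∀ v ∈ support x l, v ∈ B := hl.1.support_subset_of_inside hxB hlB
  have hsU : ∀ v ∈ support x l, v ∉ U := fun v hv ↦ (hBU (hsB v hv)).2
  have hBU' : Disjoint B U := Set.disjoint_left.2 fun v hv ↦ (hBU hv).2
  have hyB : y ∈ B := hsB y hl.1.end_mem_support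
  have heU : e ∉ G.inside U := fun hi ↦ (hBU hxB).2 (he.mem_of_inside hi).1
  have hfU : f ∉ G.inside U := fun hi ↦ (hBU hyB).2 (hf.mem_of_inside hi).1
  -- Two edges at `x'` inside `U` together with `e` and `f` would exceed degree three.
  have hne : x' ≠ y' := by
    rintro rfl
    obtain ⟨e₁, h₁, e₂, h₂, h₁₂, hi₁, hi₂⟩ := h.two_edges x' hx'
    refine hcubic.not_nodup_four hi₁ hi₂ he.inc_right hf.inc_right ?_
    simp only [List.nodup_cons, List.mem_cons, List.not_mem_nil, or_false, not_or,
      not_false_eq_true, List.nodup_nil, and_true]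
    refine ⟨⟨h₁₂, ?_, ?_⟩, ⟨?_, ?_⟩, hef⟩ <;> rintro rfl <;> contradiction
  have hel : e ∉ walkEdges l := fun hi ↦ hsU x' (hl.1.mem_support_of_inc hi he.inc_right) hx'
  have hfl : f ∉ walkEdges l := fun hi ↦ hsU y' (hl.1.mem_support_of_inc hi hf.inc_right) hy'
  set U' : Set α := {v | v ∈ support x l} ∪ U with hU'
  have hxU' : x ∈ U' := Or.inl (mem_support_self _ _)
  have heU' : e ∈ G.inside U' := he.mem_inside hxU' (Or.inr hx')
  have hfU' : f ∈ G.inside U' := hf.mem_inside (Or.inl hl.1.end_mem_support) (Or.inr hy')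
  have hlU' : ∀ g ∈ walkEdges l, g ∈ G.inside U' := fun g hg ↦ by
    obtain ⟨a, ha, b, hb, hab⟩ := hl.1.exists_link_of_mem hg
    exact hab.mem_inside (Or.inl ha) (Or.inl hb)
  refine ⟨U', X ∪ {g | g ∈ walkEdges l}, ⟨?_, ⟨x, hxU'⟩, ?_, ?_, ?_, ?_⟩,
    Set.subset_union_right, fun hle ↦ hsU x (mem_support_self _ _) (hle hxU')⟩
  · rintro v (hv | hv)
    exacts [(hBU (hsB v hv)).1, h.subset hv]
  · rintro g (hg | hg)
    exacts [inside_mono Set.subset_union_right (h.subset_inside hg), hlU' g hg]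
  · intro u hu v hv
    have huv := h.reach u hu v hv
    clear hu hv
    induction huv with
    | refl => exact Reach.refl u
    | tail _ hab ih =>
      obtain ⟨g, hg, hab⟩ := hab
      refine ih.trans ?_
      -- A deleted edge of the ear is bypassed inside `B`, whose edges are disjoint from `X`.
      by_cases hgl : g ∈ walkEdges l
      · obtain ⟨ha, hb⟩ := hab.mem_of_inside (hlB g hgl)
        refine (hBl _ ha _ hb).mono ?_
        rintro g' ⟨hg', hgl'⟩
        refine ⟨?_, ?_⟩
        · obtain ⟨a, -, b, -, hab⟩ := hg'
          exact hab.edge_mem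
        · rintro (hX | hX)
          · exact Set.disjoint_left.1 (disjoint_inside hBU') hg' (h.subset_inside hX)
          · exact hgl' hX
      · exact hab.reach ⟨hg.1, fun hX ↦ hX.elim hg.2 hgl⟩
  · rintro u (hu | hu)
    · obtain ⟨la, lb, rfl, hla, hlb⟩ := hl.1.exists_append_of_mem hu
      have hnd := hl.1.nodup_walkEdges hl.2
      rw [walkEdges_append, List.nodup_append] at hnd
      simp only [walkEdges_append, List.mem_append, not_or] at hel hfl hlU'
      obtain ⟨g₁, hg₁, hi₁⟩ : ∃ g, (g ∈ walkEdges la ∨ g = e) ∧ G.Inc g u := by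
        by_cases hla0 : la = []
        · subst hla0
          obtain rfl : x = u := hla
          exact ⟨e, Or.inr rfl, he.inc_left⟩
        · obtain ⟨g, hg, hi⟩ := hla.exists_inc_end hla0
          exact ⟨g, Or.inl hg, hi⟩
      obtain ⟨g₂, hg₂, hi₂⟩ : ∃ g, (g ∈ walkEdges lb ∨ g = f) ∧ G.Inc g u := by
        by_cases hlb0 : lb = []
        · subst hlb0
          obtain rfl : u = y := hlb
          exact ⟨f, Or.inr rfl, hf.inc_left⟩
        · obtain ⟨g, hg, hi⟩ := hlb.exists_inc_start hlb0
          exact ⟨g, Or.inl hg, hi⟩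
      refine ⟨g₁, ?_, g₂, ?_, ?_, hi₁, hi₂⟩
      · obtain hg₁ | rfl := hg₁
        exacts [hlU' g₁ (Or.inl hg₁), heU']
      · obtain hg₂ | rfl := hg₂
        exacts [hlU' g₂ (Or.inr hg₂), hfU']
      · rintro rfl
        obtain hg₁ | rfl := hg₁ <;> obtain hg₂ | rfl := hg₂
        · exact hnd.2.2 _ hg₁ _ hg₂ rfl
        · exact hfl.1 hg₁
        · exact hel.2 hg₂
        · exact hef rfl
    · obtain ⟨e₁, h₁, e₂, h₂, h'⟩ := h.two_edges u hu
      exact ⟨e₁, inside_mono Set.subset_union_right h₁, e₂, inside_mono Set.subset_union_right h₂,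
        h'⟩
  · intro Z hZ hXZ
    have hL := h.linked Z hZ (Set.subset_union_left.trans hXZ)
    have hlZ : ∀ g ∈ walkEdges l, g ∈ Z := fun g hg ↦ hXZ (Or.inr hg)
    obtain ⟨heZ, hfZ⟩ := hL.mem_of_ear hbal hZ hl hsU hlZ he hf hx' hy' hne
    exact hL.union_ear hl hsU hlZ he hf hx' hy' hne heZ hfZ

lemma IsStage.exists_isStage_vertexSet {σ : β → ℤˣ} {bal : Prop} {U : Set α} {X : Set β}
    (h : G.IsStage σ bal U X) (hbal : bal → ∀ x l, G.IsCyc x l → walkSign σ l = 1)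
    (h3 : G.IsThreeEdgeConnected) (hcubic : G.IsCubic) (hV : V(G).Finite) :
    ∃ X', G.IsStage σ bal V(G) X' := by
  have hfin : {U | ∃ X, G.IsStage σ bal U X}.Finite :=
    hV.finite_subsets.subset fun U ⟨X, hX⟩ ↦ hX.subset
  obtain ⟨W, hW⟩ := hfin.exists_maximal ⟨U, X, h⟩
  obtain ⟨X', hX'⟩ := hW.prop
  obtain hWV | hWV := (V(G) \ W).eq_empty_or_nonempty
  · obtain rfl : W = V(G) := hX'.subset.antisymm (Set.sdiff_eq_empty.1 hWV)
    exact ⟨X', hX'⟩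
  · obtain ⟨U', Y, hY, hlt⟩ := hX'.exists_larger hbal h3 hcubic hV hWV
    exact absurd (hW.le_of_ge ⟨Y, hY⟩ hlt.1) hlt.2

/-- No edge is a bridge, so a path joins the ends of `e` without using it. -/
lemma IsThreeEdgeConnected.exists_isCyc (h3 : G.IsThreeEdgeConnected)
    {e : β} {a b : α} (he : G.IsLink e a b) :
    ∃ p, G.IsCyc a ((e, b) :: p) ∧ e ∉ walkEdges p := by
  have hreach : G.Reach (E(G) \ {e}) b a := by
    by_contra hcon
    have hsub : {v | G.Reach (E(G) \ {e}) b v} ⊆ V(G) := fun v hv ↦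
      Reach.mem_of_closed hv he.right_mem fun _ _ _ _ _ h ↦ h.right_mem
    obtain ⟨g, s, t, hge, -, hs, ht, hg⟩ := h3 _ hsub ⟨b, Reach.refl b⟩ ⟨a, he.left_mem, hcon⟩ e e
    exact ht.2 (Reach.trans hs (hg.reach ⟨hg.edge_mem, hge⟩))
  obtain ⟨p, hp, hpe⟩ := hreach.exists_isPath
  have hep : e ∉ walkEdges p := fun h ↦ (hpe e h).2 rfl
  exact ⟨p, hp.isCyc_cons he hep, hep⟩

/-! ### Spanning trees -/

lemma restrict_isConnected {X : Set β} (hV : V(G).Nonempty)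
    (h : ∀ u ∈ V(G), ∀ v ∈ V(G), G.Reach X u v) : (G.restrict X).IsConnected := by
  refine ⟨hV, fun u hu v hv ↦ ?_⟩
  have huv := h u hu v hv
  clear hu hv
  induction huv with
  | refl => exact Relation.ReflTransGen.refl
  | tail _ hab ih =>
    obtain ⟨e, he, hab⟩ := hab
    exact ih.tail ⟨e, by simpa using ⟨he, hab⟩⟩

/-- An edge of a cycle of `G.restrict X` can be removed from `X` without changing
reachability. -/
lemma IsCycleEdgeSet.exists_reach {X F : Set β} (h : (G.restrict X).IsCycleEdgeSet F) :
    ∃ e ∈ X, ∀ u v, G.Reach X u v → G.Reach (X \ {e}) u v := by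
  obtain ⟨n, v, e, -, he, hl, -⟩ := h
  simp only [restrict_isLink] at hl
  have hsucc : ∀ k, Fin.ofNat (n + 1) k + 1 = Fin.ofNat (n + 1) (k + 1) := fun k ↦
    Fin.ext (by simp [Fin.val_add])
  -- The rest of the cycle, followed from vertex 1 up to vertex n + 1 = 0, replaces the edge `e 0`.
  have harc : ∀ k, k ≤ n →
      G.Reach (X \ {e 0}) (v (Fin.ofNat (n + 1) 1)) (v (Fin.ofNat (n + 1) (k + 1))) := by
    intro k
    induction k with
    | zero => exact fun _ ↦ Reach.refl _
    | succ k ih =>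
      intro hk
      have hlk := hl (Fin.ofNat (n + 1) (k + 1))
      rw [hsucc] at hlk
      refine (ih (by omega)).trans (hlk.2.reach ⟨hlk.1, fun h0 ↦ ?_⟩)
      have h1 := congrArg Fin.val (he h0)
      rw [Fin.val_ofNat, Nat.mod_eq_of_lt (by omega)] at h1
      simp at h1
  have h0 : Fin.ofNat (n + 1) 0 = 0 := rfl
  have hlast : Fin.ofNat (n + 1) (n + 1) = 0 := Fin.ext (by simp)
  have hloop := hl 0
  have hback := harc n le_rfl
  rw [← h0, hsucc] at hloop
  rw [hlast] at hback
  refine ⟨e 0, hloop.1, fun a b hab ↦ ?_⟩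
  induction hab with
  | refl => exact Reach.refl a
  | tail _ hbc ih =>
    obtain ⟨g, hg, hbc⟩ := hbc
    refine ih.trans ?_
    by_cases hg0 : g = e 0
    · subst hg0
      obtain ⟨rfl, rfl⟩ | ⟨rfl, rfl⟩ := hbc.eq_and_eq_or_eq_and_eq hloop.2
      exacts [hback.symm, hback]
    · exact hbc.reach ⟨hg, hg0⟩

/-- A minimal connecting subset of `F` has no cycle, since an edge of a cycle could be dropped. -/
lemma exists_isSpanningTree {F : Set β} (hE : E(G).Finite) (hF : F ⊆ E(G)) (hV : V(G).Nonempty)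
    (h : ∀ u ∈ V(G), ∀ v ∈ V(G), G.Reach F u v) : ∃ X ⊆ F, G.IsSpanningTree X := by
  have hfin : {Y | Y ⊆ F ∧ ∀ u ∈ V(G), ∀ v ∈ V(G), G.Reach Y u v}.Finite :=
    (hE.subset hF).finite_subsets.subset fun Y hY ↦ hY.1
  obtain ⟨X, hX⟩ := hfin.exists_minimal ⟨F, subset_rfl, h⟩
  refine ⟨X, hX.prop.1, hX.prop.1.trans hF, restrict_isConnected hV hX.prop.2, fun C hC ↦ ?_⟩
  obtain ⟨e, he, hr⟩ := hC.exists_reach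
  exact (hX.le_of_le (y := X \ {e}) ⟨Set.sdiff_subset.trans hX.prop.1,
    fun u hu v hv ↦ hr u v (hX.prop.2 u hu v hv)⟩ Set.sdiff_subset he).2 rfl

/-! ### The initial stage and the theorem -/

lemma exists_isStage {σ : β → ℤˣ} (h3 : G.IsThreeEdgeConnected)
    (hloop : ∀ e v, ¬ G.IsLink e v v) (hV : V(G).Finite) (hE : E(G).Nonempty) :
    ∃ U X, G.IsStage σ (∀ x l, G.IsCyc x l → walkSign σ l = 1) U X := by
  classical
  by_cases hbal : ∀ x l, G.IsCyc x l → walkSign σ l = 1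
  · obtain ⟨e, he⟩ := hE
    obtain ⟨a, b, hab⟩ := exists_isLink_of_mem_edgeSet he
    obtain ⟨p, hp, hep⟩ := h3.exists_isCyc hab
    -- With all cycles positive for `σ`, the nonseparating cycle comes from an auxiliary signature
    -- that is negative on `e` alone, for which a cycle through `e` is negative.
    have hs : walkSign (fun g ↦ if g = e then -1 else 1) ((e, b) :: p) = -1 := by
      have hp1 : walkSign (fun g ↦ if g = e then -1 else 1) p = 1 := by
        refine List.prod_eq_one fun s hs ↦ ?_
        obtain ⟨q, hq, rfl⟩ := List.mem_map.1 hs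
        have hqe : q.1 ≠ e := by
          rintro rfl
          exact hep (List.mem_map_of_mem hq)
        exact if_neg hqe
      rw [walkSign_cons, hp1]
      simp
    obtain ⟨y, c, hc, -, hr⟩ := h3.exists_nonseparating_isCyc hV hp hs
    exact ⟨_, _, hc.isStage hloop (Or.inl hbal) hr⟩
  · have hneg := hbal
    push Not at hneg
    obtain ⟨x, l, hl, hs⟩ := hneg
    obtain ⟨y, c, hc, hcs, hr⟩ := h3.exists_nonseparating_isCyc hV hl
      ((Int.units_eq_one_or _).resolve_left hs)
    exact ⟨_, _, hc.isStage hloop (Or.inr hcs) hr⟩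

end Graph

theorem mainTheorem6 {α β : Type*} (G : Graph α β) (σ : β → ℤˣ)
    (hVfin : G.vertexSet.Finite) (hEfin : G.edgeSet.Finite)
    (hconn : G.IsVertexConnected 3) (hcubic : G.IsCubic) :
    ∃ X₁ X₂ : Set β, X₁ ∪ X₂ = G.edgeSet ∧ Disjoint X₁ X₂ ∧
      G.IsSpanningTree X₁ ∧ G.IsKBase σ 2 X₂ := by
  have hVnt : G.vertexSet.Nontrivial := by
    rw [← Set.one_lt_encard_iff_nontrivial]
    exact lt_trans (by norm_num) hconn.1
  have h3 := hconn.isThreeEdgeConnected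
  have hloop := h3.not_isLink_self hcubic hVnt
  have hE : G.edgeSet.Nonempty := by
    obtain ⟨x, hx⟩ := hVnt.nonempty
    by_contra hE
    rw [Set.not_nonempty_iff_eq_empty] at hE
    have h0 : G.incidenceSet x = ∅ := Set.subset_empty_iff.1 (hE ▸ G.incidenceSet_subset_edgeSet x)
    have h1 : G.loopSet x = ∅ :=
      Set.subset_empty_iff.1 (h0 ▸ G.loopSet_subset_incidenceSet x)
    have := hcubic x hx
    rw [Graph.edegree, h0, h1] at this
    simp at this
  obtain ⟨U, X₀, hU⟩ := Graph.exists_isStage (σ := σ) h3 hloop hVfin hE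
  -- Here `bal` is the statement that every cycle is positive, so `id` proves the implication
  -- required of it.
  obtain ⟨X, hX⟩ := hU.exists_isStage_vertexSet id h3 hcubic hVfin
  obtain ⟨X₁, hX₁, htree⟩ :=
    Graph.exists_isSpanningTree hEfin Set.sdiff_subset hVnt.nonempty hX.reach
  refine ⟨X₁, G.edgeSet \ X₁, Set.union_sdiff_cancel htree.1, Set.disjoint_sdiff_right, htree,
    Set.sdiff_subset, ?_⟩
  have hcl := (G.isLeast_kClosure σ 2 (S := G.edgeSet \ X₁) Set.sdiff_subset).1
  refine hcl.1.antisymm fun e he ↦ ?_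
  obtain ⟨u, v, huv⟩ := Graph.exists_isLink_of_mem_edgeSet he
  have hXE : X ⊆ G.edgeSet := Graph.inside_vertexSet (G := G) ▸ hX.subset_inside
  have hXcl : X ⊆ G.kClosure σ 2 (G.edgeSet \ X₁) :=
    fun g hg ↦ hcl.2.1 ⟨hXE hg, fun hg₁ ↦ (hX₁ hg₁).2 hg⟩
  -- The closure is a 2-closed set containing `X`, so it links all of V(G) and captures each edge,
  -- there being no loops.
  refine (hX.linked _ hcl.2.2 hXcl).mem_of_isLink id hcl.2.2 huv huv.left_mem huv.right_mem ?_
  rintro rfl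
  exact hloop e u huv
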